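/- **Lemma (very noisy channel, deadline $L=4$).** All logarithms are natural. A discrete memoryless channel with finite alphabets and transition probabilities $p(j|k)$ is called *$\eta$-noisy* if $p(j|k)=\omega_j(1+\epsilon_{jk})$, where $(\omega_j)$ is a probability distribution on the outputs, $\sum_j\omega_j\epsilon_{jk}=0$ for every input $k$, and $|\epsilon_{jk}|\le\eta$ for all $j,k$. The very noisy channel is the limit $\eta\to0$, in which exponents are compared to leading order, i.e. relative to the capacity $C$. *Feedback exponent.* With $$E_o(s,\rho,\mathbf p)=-\log\sum_y\Big(\sum_x p(x)p(y|x)^{1-s}\Big)\Big(\sum_x p(x)p(y|x)^{s/\rho}\Big)^{\rho},$$ $$E_x(s,\rho,\mathbf p)=-\rho\log\sum_{x,x_1}p(x)p(x_1)\Big(\sum_y p(y|x)^{1-s}p(y|x_1)^s\Big)^{1/\rho},$$ let $E_1(R,T)$ be the larger of $\sup_{0\le s\le\rho\le1,\,\mathbf p}\,[E_o(s,\rho,\mathbf p)-\rho R-sT]$ and $\sup_{0\le s\le1\le\rho,\,\mathbf p}\,[E_x(s,\rho,\mathbf p)-\rho R-sT]$, where $\mathbf p$ ranges over the input distributions and the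 point $s=\rho=0$ contributes $0$. Forney's feedback exponent is $E_F(R)=\lim_{E_1(R,T)\to0}T$, i.e. the least $T\ge0$ with $E_1(R,T)=0$. *IR-ARQ with deadline $L$.* One of $M$ equally likely messages is sent. Its codeword has $L$ blocks of $N$ symbols, all code symbols being i.i.d. with a capacity-achieving law. The blocks are sent one per round. After round $k<L$ the receiver uses all $kN$ received symbols and decides on message $m$ if $p(\mathbf y|\mathbf x_m)\ge e^{kNT_k}\sum_{i\ne m}p(\mathbf y|\mathbf x_i)$ (ties broken arbitrarily); if no message qualifies, it asks for the next block. After round $L$ it uses maximum likelihood decoding. Let $\Pr(E)$ be the average error probability and $\overline\tau$ the average decoding delay in channel uses, both also averaged over the random code. The exponent $E_{IR}(R,L)$ achieved at rate $R$ is the supremum of $\limsup_{N\to\infty}-\log\Pr(E)/\overline\tau$ over all choices of thresholds $T_k\ge0$ and message numbers $M=M_N\to\infty$ for which the average rate $\log M_N/\overline\tau$ tends to $R$. **Claim.** A deadline of $L=4$ suffices for IR-ARQ to achieve the feedback exponent on the very noisy channel at all rates $0\le R\le C$. Precisely: for every $\delta>0$ there is an $\eta>0$ such that for every $\eta$-noisy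 channel (with any finite alphabets), with capacity $C$, for every capacity-achieving input law used by IR-ARQ, and for all $0\le R\le C$, $$\big|E_F(R)-\big[(C-R)+(\sqrt C-\sqrt R)^2\big]\big|\le\delta C\qquad\text{and}\qquad E_{IR}(R,4)\ge E_F(R)-\delta C .$$ -/

import Mathlib

open Filter Topology

universe u v

noncomputable section

namespace ARQ

/-! ### Channels, capacity, very noisy channels

A discrete memoryless channel with finite input alphabet `X` and finite output alphabet `Y` is given
by its transition probabilities `W x y = p(y|x)`. All logarithms are natural. -/

/-- `W` is a channel whose outputs are almost independent of its inputs, at noise level `η`: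
`p(j|k) = ω_j (1 + ε_{jk})` for a probability distribution `ω` on the outputs and numbers `ε_{jk}`
with `∑_j ω_j ε_{jk} = 0` and `|ε_{jk}| ≤ η`. -/
def IsVeryNoisy {X : Type u} {Y : Type v} [Fintype Y] (η : ℝ) (W : X → Y → ℝ) : Prop :=
  ∃ (ω : Y → ℝ) (ε : Y → X → ℝ),
    (∀ j, 0 ≤ ω j) ∧ (∑ j, ω j = 1) ∧ (∀ k, ∑ j, ω j * ε j k = 0) ∧
    (∀ j k, |ε j k| ≤ η) ∧ ∀ k j, W k j = ω j * (1 + ε j k)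

/-- Mutual information (in nats) of the channel `W` under the input distribution `p`. -/
def mutualInfo {X : Type u} {Y : Type v} [Fintype X] [Fintype Y] (W : X → Y → ℝ) (p : X → ℝ) : ℝ :=
  ∑ x, ∑ y, p x * W x y * Real.log (W x y / ∑ x', p x' * W x' y)

/-- Channel capacity: the maximum of the mutual information over the input distributions. -/
def capacity {X : Type u} {Y : Type v} [Fintype X] [Fintype Y] (W : X → Y → ℝ) : ℝ :=
  sSup (mutualInfo W '' stdSimplex ℝ X)

/-- `p` is a capacity-achieving input distribution of `W`. -/
def IsCapacityAchieving {X : Type u} {Y : Type v} [Fintype X] [Fintype Y]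
    (W : X → Y → ℝ) (p : X → ℝ) : Prop :=
  p ∈ stdSimplex ℝ X ∧ mutualInfo W p = capacity W

/-! ### Forney's erasure exponent and the feedback exponent -/

/-- `E_o(s, ρ, p) = -log ∑_y (∑_x p(x) p(y|x)^{1-s}) (∑_x p(x) p(y|x)^{s/ρ})^ρ`. -/
def Eo {X : Type u} {Y : Type v} [Fintype X] [Fintype Y] (W : X → Y → ℝ)
    (s ρ : ℝ) (p : X → ℝ) : ℝ :=
  -Real.log (∑ y, (∑ x, p x * W x y ^ (1 - s)) * (∑ x, p x * W x y ^ (s / ρ)) ^ ρ)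

/-- `E_x(s, ρ, p) = -ρ log ∑_{x, x₁} p(x) p(x₁) (∑_y p(y|x)^{1-s} p(y|x₁)^s)^{1/ρ}`. -/
def Ex {X : Type u} {Y : Type v} [Fintype X] [Fintype Y] (W : X → Y → ℝ)
    (s ρ : ℝ) (p : X → ℝ) : ℝ :=
  -ρ * Real.log (∑ x, ∑ x₁, p x * p x₁ * (∑ y, W x y ^ (1 - s) * W x₁ y ^ s) ^ (1 / ρ))

/-- The erasure exponent `E_1(R, T)`: the larger of the random coding expression (which is the
larger one at high rates) and the expurgated expression (low rates). The point `s = ρ = 0`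
contributes the value `0` to the first one, so that `E_1(R, T) ≥ 0`. -/
def E1 {X : Type u} {Y : Type v} [Fintype X] [Fintype Y] (W : X → Y → ℝ) (R T : ℝ) : EReal :=
  sSup {e : EReal | ∃ (s ρ : ℝ) (p : X → ℝ), 0 ≤ s ∧ s ≤ ρ ∧ ρ ≤ 1 ∧ p ∈ stdSimplex ℝ X ∧
      e = ((Eo W s ρ p - ρ * R - s * T : ℝ) : EReal)} ⊔
  sSup {e : EReal | ∃ (s ρ : ℝ) (p : X → ℝ), 0 ≤ s ∧ s ≤ 1 ∧ 1 ≤ ρ ∧ p ∈ stdSimplex ℝ X ∧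
      e = ((Ex W s ρ p - ρ * R - s * T : ℝ) : EReal)}

/-- The feedback exponent `E_F(R) = lim_{E_1(R,T) → 0} T`. As a function of `T ≥ 0`, `E_1(R, T)` is
nonnegative, convex and nonincreasing, so that the limit is the least `T ≥ 0` at which `E_1(R, T)`
vanishes. -/
def feedbackExponent {X : Type u} {Y : Type v} [Fintype X] [Fintype Y]
    (W : X → Y → ℝ) (R : ℝ) : EReal :=
  sInf {e : EReal | ∃ T : ℝ, 0 ≤ T ∧ E1 W R T = 0 ∧ e = (T : EReal)}

/-! ### Incremental redundancy ARQ with a deadline of `L` rounds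

There are `L` rounds of `N` symbols. A codeword and a received sequence are indexed by the round and
the position in the round. New code symbols are used in each round. -/

/-- `p(y|x)` for the received sequence and the codeword of the first `k` rounds (`kN` symbols). -/
def likelihood {X : Type u} {Y : Type v} {L N : ℕ} (W : X → Y → ℝ) (k : ℕ)
    (x : Fin L → Fin N → X) (y : Fin L → Fin N → Y) : ℝ :=
  ∏ r ∈ Finset.univ.filter (fun r : Fin L => r.val < k), ∏ i, W (x r i) (y r i)

/-- The received sequence of the first `k` rounds lies in the decision region of message `m`:
`p(y|x_m) / ∑_{i ≠ m} p(y|x_i) ≥ e^{kNt}`. -/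
def InRegion {X : Type u} {Y : Type v} {M L N : ℕ} (W : X → Y → ℝ) (k : ℕ) (t : ℝ)
    (c : Fin M → Fin L → Fin N → X) (y : Fin L → Fin N → Y) (m : Fin M) : Prop :=
  Real.exp (k * N * t) * ∑ i ∈ Finset.univ.erase m, likelihood W k (c i) y
    ≤ likelihood W k (c m) y

open Classical in
/-- The erasure decoder after `k` rounds, with threshold `t`; `none` is an erasure. -/
def erasureDecode {X : Type u} {Y : Type v} {M L N : ℕ} (W : X → Y → ℝ) (k : ℕ) (t : ℝ)
    (c : Fin M → Fin L → Fin N → X) (y : Fin L → Fin N → Y) : Option (Fin M) :=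
  if h : ∃ m, InRegion W k t c y m then some h.choose else none

open Classical in
/-- The maximum likelihood decoder after all `L` rounds (it never erases, unless `M = 0`). -/
def mlDecode {X : Type u} {Y : Type v} {M L N : ℕ} (W : X → Y → ℝ)
    (c : Fin M → Fin L → Fin N → X) (y : Fin L → Fin N → Y) : Option (Fin M) :=
  if h : ∃ m, ∀ i, likelihood W L (c i) y ≤ likelihood W L (c m) y then some h.choose else none

/-- The number of ARQ rounds that are used: the first `k ∈ {1, …, L-1}` for which the erasure
decoder (with threshold `T k` after `k` rounds) does not erase, and `L` if there is none. -/
def rounds {X : Type u} {Y : Type v} {M L N : ℕ} (W : X → Y → ℝ) (T : ℕ → ℝ)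
    (c : Fin M → Fin L → Fin N → X) (y : Fin L → Fin N → Y) : ℕ :=
  sInf {k : ℕ | (1 ≤ k ∧ k < L ∧ erasureDecode W k (T k) c y ≠ none) ∨ k = L}

/-- The final decision of the receiver: the decision of the erasure decoder if it stops before the
`L`-th round, and the maximum likelihood decision otherwise. -/
def decision {X : Type u} {Y : Type v} {M L N : ℕ} (W : X → Y → ℝ) (T : ℕ → ℝ)
    (c : Fin M → Fin L → Fin N → X) (y : Fin L → Fin N → Y) : Option (Fin M) :=
  if rounds W T c y < L then erasureDecode W (rounds W T c y) (T (rounds W T c y)) c y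
  else mlDecode W c y

/-- Expectation of a function of the codebook, the message and the channel outputs: all code symbols
are i.i.d. with law `p`, the message is uniform on `M` values, and the channel is memoryless.
(Outputs are drawn for all `L` rounds; those after the last round used have no influence.) -/
def mean {X : Type u} {Y : Type v} [Fintype X] [Fintype Y] (W : X → Y → ℝ) (p : X → ℝ)
    {M L N : ℕ} (f : (Fin M → Fin L → Fin N → X) → Fin M → (Fin L → Fin N → Y) → ℝ) : ℝ :=
  ∑ c : Fin M → Fin L → Fin N → X, (∏ m, ∏ r, ∏ i, p (c m r i)) *
    ((1 / (M : ℝ)) * ∑ m, ∑ y : Fin L → Fin N → Y, likelihood W L (c m) y * f c m y)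

open Classical in
/-- Average probability of error of IR-ARQ. -/
def prError {X : Type u} {Y : Type v} [Fintype X] [Fintype Y] (W : X → Y → ℝ) (p : X → ℝ)
    (L N M : ℕ) (T : ℕ → ℝ) : ℝ :=
  mean W p (M := M) (L := L) (N := N) fun c m y => if decision W T c y = some m then 0 else 1

/-- Average decoding delay of IR-ARQ, in channel uses. -/
def avgDelay {X : Type u} {Y : Type v} [Fintype X] [Fintype Y] (W : X → Y → ℝ) (p : X → ℝ)
    (L N M : ℕ) (T : ℕ → ℝ) : ℝ :=
  mean W p (M := M) (L := L) (N := N) fun c _ y => (N : ℝ) * (rounds W T c y : ℝ)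

/-- `E_IR(R, L)`: the error exponent achieved by IR-ARQ with deadline `L` at rate `R` when the code
symbols are drawn i.i.d. from `p`. It is the supremum of `limsup_N -log Pr(E) / τ̄` over the numbers
`M N` of messages (`M N → ∞`, which matters only for `R = 0`) and the thresholds `T k ≥ 0` for which
the average rate `log (M N) / τ̄` tends to `R`. -/
def irExponent {X : Type u} {Y : Type v} [Fintype X] [Fintype Y] (W : X → Y → ℝ) (p : X → ℝ)
    (R : ℝ) (L : ℕ) : EReal :=
  sSup {e : EReal | ∃ (M : ℕ → ℕ) (T : ℕ → ℝ), (∀ k, 0 ≤ T k) ∧ Tendsto M atTop atTop ∧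
    Tendsto (fun N => Real.log (M N) / avgDelay W p L N (M N) T) atTop (𝓝 R) ∧
    e = limsup (fun N => (-ENNReal.log (ENNReal.ofReal (prError W p L N (M N) T))) /
      ((avgDelay W p L N (M N) T : ℝ) : EReal)) atTop}

end ARQ

end

/-!
For a very noisy channel everything is governed by `χ = ∑ x, ∑ y, p x * q y * e x y ^ 2`, where `q`
is the output distribution and `W x y = q y * (1 + e x y)`: to first order in `χ` the mutual
information is `χ / 2`, and second order expansions give
`Eo W s ρ p ≈ s * (2 - s - s / ρ) * C` and `Ex W s ρ p ≤ 2 * s * (1 - s) * C`, up to factors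
`1 + O(η)` which depend neither on the alphabets nor on `s` and `ρ`.

The feedback exponent is then the largest `T` with `ρ * R + s * T ≤ s * (2 - s / ρ) * C` for some
`s / ρ`, the term `-s ^ 2 * C` being negligible for small `ρ`. For `w = s / ρ` this is
`T ≤ (2 - w) * C - R / w`, which is largest at `w = √(R / C)`, with value
`2 * C - 2 * √(C * R) = (C - R) + (√C - √R) ^ 2`. The bound at `ρ = 1` also covers the expurgated
exponents.

For IR-ARQ take all thresholds equal to a constant `t` slightly below this value. By the random
coding bound with the same `s` and `ρ`, the first round almost always ends in a decision, so that
the average delay is asymptotically `N`. A wrong decision in round `k < L` requires the sent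
codeword to be less likely than a wrong one by a factor `exp (k * N * t)`, which has probability at
most `exp (-(k * N * t))`. The maximum likelihood decision of the last round uses `L * N` symbols,
and the random coding bound at `s = 1 / 2`, `ρ = 1` gives it the exponent `L * C / 2 - R`. For
`L ≥ 4` this is at least `2 * C - R ≥ 2 * C - 2 * √(C * R)`.
-/

noncomputable section

namespace ARQ

/-! ### Second order bounds near `1` -/

theorem tangent_add_sq_le_of_le_deriv2 {D : Set ℝ} (hD : Convex ℝ D) {f f' f'' : ℝ → ℝ} {m : ℝ}
    (hf : ∀ x ∈ D, HasDerivAt f (f' x) x) (hf' : ∀ x ∈ D, HasDerivAt f' (f'' x) x)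
    (hm : ∀ x ∈ D, m ≤ f'' x) {a x : ℝ} (ha : a ∈ D) (hx : x ∈ D) :
    f a + f' a * (x - a) + m / 2 * (x - a) ^ 2 ≤ f x := by
  set g : ℝ → ℝ := fun x => f x - m / 2 * (x - a) ^ 2
  have hg : ∀ x ∈ D, HasDerivAt g (f' x - m * (x - a)) x := fun x hx => by
    refine ((hf x hx).sub
      ((((hasDerivAt_id x).sub_const a).pow 2).const_mul (m / 2))).congr_deriv ?_
    simp only [id, Nat.cast_ofNat]
    ring
  have hg' : ∀ x ∈ D, HasDerivAt (fun x => f' x - m * (x - a)) (f'' x - m) x := fun x hx =>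
    ((hf' x hx).sub (((hasDerivAt_id x).sub_const a).const_mul m)).congr_deriv (by simp)
  have hconv : ConvexOn ℝ D g :=
    convexOn_of_hasDerivWithinAt2_nonneg hD
      (fun x hx => (hg x hx).continuousAt.continuousWithinAt)
      (fun x hx => (hg x (interior_subset hx)).hasDerivWithinAt)
      (fun x hx => (hg' x (interior_subset hx)).hasDerivWithinAt)
      (fun x hx => sub_nonneg.2 (hm x (interior_subset hx)))
  have hga : HasDerivAt g (f' a) a := by simpa using hg a ha
  suffices htangent : g a + f' a * (x - a) ≤ g x by
    simp only [g, sub_self] at htangent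
    linarith
  rcases lt_trichotomy x a with hxa | rfl | hax
  · have := hconv.slope_le_of_hasDerivAt hx ha hxa hga
    rw [slope_def_field, div_le_iff₀ (by linarith)] at this
    linarith
  · simp
  · have := hconv.le_slope_of_hasDerivAt ha hx hax hga
    rw [slope_def_field, le_div_iff₀ (by linarith)] at this
    linarith

theorem le_tangent_add_sq_of_deriv2_le {D : Set ℝ} (hD : Convex ℝ D) {f f' f'' : ℝ → ℝ} {m : ℝ}
    (hf : ∀ x ∈ D, HasDerivAt f (f' x) x) (hf' : ∀ x ∈ D, HasDerivAt f' (f'' x) x)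
    (hm : ∀ x ∈ D, f'' x ≤ m) {a x : ℝ} (ha : a ∈ D) (hx : x ∈ D) :
    f x ≤ f a + f' a * (x - a) + m / 2 * (x - a) ^ 2 := by
  have := tangent_add_sq_le_of_le_deriv2 hD (fun x hx => (hf x hx).neg)
    (fun x hx => (hf' x hx).neg) (fun x hx => neg_le_neg (hm x hx)) ha hx
  simp only [Pi.neg_apply] at this
  linarith

theorem hasDerivAt_one_add_rpow (a : ℝ) {x : ℝ} (hx : 0 < 1 + x) :
    HasDerivAt (fun x : ℝ => (1 + x) ^ a) (a * (1 + x) ^ (a - 1)) x := by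
  simpa using ((hasDerivAt_id x).const_add 1).rpow_const (p := a) (Or.inl hx.ne')

theorem one_add_rpow_bounds_of_neg_two_le {b x θ : ℝ} (hb : -2 ≤ b) (hb0 : b ≤ 0)
    (hθ : θ ≤ 1 / 4) (hx : |x| ≤ θ) :
    1 - 4 * θ ≤ (1 + x) ^ b ∧ (1 + x) ^ b ≤ 1 + 4 * θ := by
  have hθ0 : 0 ≤ θ := (abs_nonneg x).trans hx
  obtain ⟨hx₁, hx₂⟩ := abs_le.1 hx
  have hpos : 0 < 1 - θ := by linarith
  have rpow_neg_two : ∀ z : ℝ, 0 ≤ z → z ^ (-2 : ℝ) = (z ^ 2)⁻¹ := fun z hz => by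
    rw [Real.rpow_neg hz, Real.rpow_two]
  constructor
  · calc 1 - 4 * θ ≤ ((1 + θ) ^ 2)⁻¹ := by
          rw [← one_div, le_div_iff₀ (by positivity)]
          nlinarith [pow_nonneg hθ0 2, pow_nonneg hθ0 3]
      _ = (1 + θ) ^ (-2 : ℝ) := (rpow_neg_two _ (by linarith)).symm
      _ ≤ (1 + θ) ^ b := Real.rpow_le_rpow_of_exponent_le (by linarith) hb
      _ ≤ (1 + x) ^ b := Real.rpow_le_rpow_of_nonpos (by linarith) (by linarith) hb0
  · calc (1 + x) ^ b ≤ (1 - θ) ^ b := Real.rpow_le_rpow_of_nonpos hpos (by linarith) hb0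
      _ ≤ (1 - θ) ^ (-2 : ℝ) := Real.rpow_le_rpow_of_exponent_ge hpos (by linarith) hb
      _ = ((1 - θ) ^ 2)⁻¹ := rpow_neg_two _ hpos.le
      _ ≤ 1 + 4 * θ := by
          rw [← one_div, div_le_iff₀ (by positivity)]
          nlinarith [pow_nonneg hθ0 3, mul_nonneg hθ0 (sub_nonneg.2 hθ)]

theorem one_add_rpow_bounds {a x θ : ℝ} (ha : 0 ≤ a) (ha1 : a ≤ 1) (hθ : θ ≤ 1 / 4)
    (hx : |x| ≤ θ) :
    1 + a * x - a * (1 - a) * (1 + 4 * θ) / 2 * x ^ 2 ≤ (1 + x) ^ a ∧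
      (1 + x) ^ a ≤ 1 + a * x - a * (1 - a) * (1 - 4 * θ) / 2 * x ^ 2 := by
  have hpos : ∀ x ∈ Set.Icc (-θ) θ, 0 < 1 + x := fun x hx => by linarith [hx.1]
  have hderiv : ∀ x ∈ Set.Icc (-θ) θ,
      HasDerivAt (fun x : ℝ => (1 + x) ^ a) (a * (1 + x) ^ (a - 1)) x :=
    fun x hx => hasDerivAt_one_add_rpow a (hpos x hx)
  have hderiv2 : ∀ x ∈ Set.Icc (-θ) θ, HasDerivAt (fun x : ℝ => a * (1 + x) ^ (a - 1))
      (-(a * (1 - a)) * (1 + x) ^ (a - 2)) x := fun x hx => by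
    refine ((hasDerivAt_one_add_rpow (a - 1) (hpos x hx)).const_mul a).congr_deriv ?_
    rw [show a - 1 - 1 = a - 2 by ring]
    ring
  have hbounds := fun x (hx : x ∈ Set.Icc (-θ) θ) => one_add_rpow_bounds_of_neg_two_le
    (b := a - 2) (by linarith) (by linarith) hθ (abs_le.2 hx)
  have ha2 : -(a * (1 - a)) ≤ 0 := neg_nonpos.2 (mul_nonneg ha (by linarith))
  have h0 : (0 : ℝ) ∈ Set.Icc (-θ) θ := abs_le.1 (by simpa using (abs_nonneg x).trans hx)
  constructor
  · have := tangent_add_sq_le_of_le_deriv2 (convex_Icc _ _) hderiv hderiv2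
      (fun x hx => mul_le_mul_of_nonpos_left (hbounds x hx).2 ha2) h0 (abs_le.1 hx)
    simp only [add_zero, sub_zero, Real.one_rpow] at this
    linarith
  · have := le_tangent_add_sq_of_deriv2_le (convex_Icc _ _) hderiv hderiv2
      (fun x hx => mul_le_mul_of_nonpos_left (hbounds x hx).1 ha2) h0 (abs_le.1 hx)
    simp only [add_zero, sub_zero, Real.one_rpow] at this
    linarith

theorem one_add_mul_log_bounds {x θ : ℝ} (hθ : θ ≤ 1 / 4) (hx : |x| ≤ θ) :
    x + (1 - 4 * θ) / 2 * x ^ 2 ≤ (1 + x) * Real.log (1 + x) ∧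
      (1 + x) * Real.log (1 + x) ≤ x + (1 + 4 * θ) / 2 * x ^ 2 := by
  have hpos : ∀ x ∈ Set.Icc (-θ) θ, 0 < 1 + x := fun x hx => by linarith [hx.1]
  have hlog : ∀ x ∈ Set.Icc (-θ) θ,
      HasDerivAt (fun x : ℝ => Real.log (1 + x)) ((1 + x) ^ (-1 : ℝ)) x := fun x hx => by
    simpa [Real.rpow_neg_one] using ((hasDerivAt_id x).const_add 1).log (hpos x hx).ne'
  have hderiv : ∀ x ∈ Set.Icc (-θ) θ,
      HasDerivAt (fun x : ℝ => (1 + x) * Real.log (1 + x)) (Real.log (1 + x) + 1) x :=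
    fun x hx => by
      refine (((hasDerivAt_id x).const_add 1).mul (hlog x hx)).congr_deriv ?_
      simp [Real.rpow_neg_one, mul_inv_cancel₀ (hpos x hx).ne']
  have hderiv2 : ∀ x ∈ Set.Icc (-θ) θ,
      HasDerivAt (fun x : ℝ => Real.log (1 + x) + 1) ((1 + x) ^ (-1 : ℝ)) x :=
    fun x hx => (hlog x hx).add_const 1
  have hbounds := fun x (hx : x ∈ Set.Icc (-θ) θ) => one_add_rpow_bounds_of_neg_two_le
    (b := -1) (by norm_num) (by norm_num) hθ (abs_le.2 hx)
  have h0 : (0 : ℝ) ∈ Set.Icc (-θ) θ := abs_le.1 (by simpa using (abs_nonneg x).trans hx)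
  constructor
  · simpa using tangent_add_sq_le_of_le_deriv2 (convex_Icc _ _) hderiv hderiv2
      (fun x hx => (hbounds x hx).1) h0 (abs_le.1 hx)
  · simpa using le_tangent_add_sq_of_deriv2_le (convex_Icc _ _) hderiv hderiv2
      (fun x hx => (hbounds x hx).2) h0 (abs_le.1 hx)

theorem rpow_one_sub_mul_rpow {x : ℝ} (hx : 0 ≤ x) (s : ℝ) : x ^ (1 - s) * x ^ s = x := by
  rw [← Real.rpow_add' hx (by simp), sub_add_cancel, Real.rpow_one]

theorem neg_log_le_mul_one_sub {x θ : ℝ} (hθ : θ ≤ 1 / 2) (hx : 1 - θ ≤ x) (hx1 : x ≤ 1) :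
    -Real.log x ≤ (1 + 2 * θ) * (1 - x) := by
  have hx0 : 0 < x := by linarith
  calc -Real.log x ≤ x⁻¹ - 1 := by linarith [Real.one_sub_inv_le_log_of_pos hx0]
    _ = (1 - x) / x := by field_simp
    _ ≤ (1 + 2 * θ) * (1 - x) := by
        rw [div_le_iff₀ hx0]
        nlinarith [mul_nonneg (sub_nonneg.2 hx1) (sub_nonneg.2 hx),
          mul_nonneg (sub_nonneg.2 hx1) (sub_nonneg.2 hθ)]

theorem sum_mul_log_le {ι : Type*} [Fintype ι] {w z : ι → ℝ} (hw : w ∈ stdSimplex ℝ ι)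
    (hz : ∀ i, 0 < z i) : ∑ i, w i * Real.log (z i) ≤ Real.log (∑ i, w i * z i) := by
  simpa only [smul_eq_mul] using
    strictConcaveOn_log_Ioi.concaveOn.le_map_sum (fun i _ => hw.1 i) hw.2 (fun i _ => hz i)

theorem sum_mul_pos {ι : Type*} [Fintype ι] {w z : ι → ℝ} (hw : w ∈ stdSimplex ℝ ι)
    (hz : ∀ i, 0 < z i) : 0 < ∑ i, w i * z i := by
  obtain ⟨i, -, hi⟩ :=
    Finset.exists_ne_zero_of_sum_ne_zero (ne_of_eq_of_ne hw.2 (one_ne_zero (α := ℝ)))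
  exact Finset.sum_pos' (fun i _ => mul_nonneg (hw.1 i) (hz i).le)
    ⟨i, Finset.mem_univ _, mul_pos ((hw.1 i).lt_of_ne' hi) (hz i)⟩

theorem sum_mul_le_of_mem_stdSimplex {ι : Type*} [Fintype ι] {w z : ι → ℝ} {B : ℝ}
    (hw : w ∈ stdSimplex ℝ ι) (hz : ∀ i, z i ≤ B) : ∑ i, w i * z i ≤ B :=
  calc ∑ i, w i * z i ≤ ∑ i, w i * B :=
        Finset.sum_le_sum fun i _ => mul_le_mul_of_nonneg_left (hz i) (hw.1 i)
    _ = B := by rw [← Finset.sum_mul, hw.2, one_mul]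

theorem le_sum_mul_of_mem_stdSimplex {ι : Type*} [Fintype ι] {w z : ι → ℝ} {B : ℝ}
    (hw : w ∈ stdSimplex ℝ ι) (hz : ∀ i, B ≤ z i) : B ≤ ∑ i, w i * z i :=
  calc B = ∑ i, w i * B := by rw [← Finset.sum_mul, hw.2, one_mul]
    _ ≤ ∑ i, w i * z i :=
        Finset.sum_le_sum fun i _ => mul_le_mul_of_nonneg_left (hz i) (hw.1 i)

/-! ### Channels relative to their output distribution -/

section Centered

variable {X : Type u} {Y : Type v} [Fintype X] [Fintype Y]

/-- The channel `W` with input distribution `p` is written relative to its output distribution `q`: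
`W x y = q y (1 + e x y)`, where the deviation `e` is at most `θ` in absolute value. -/
structure IsCentered (W : X → Y → ℝ) (p : X → ℝ) (q : Y → ℝ) (e : X → Y → ℝ) (θ : ℝ) : Prop where
  input_mem : p ∈ stdSimplex ℝ X
  output_mem : q ∈ stdSimplex ℝ Y
  eq : ∀ x y, W x y = q y * (1 + e x y)
  sum_output : ∀ x, ∑ y, q y * e x y = 0
  sum_input : ∀ y, ∑ x, p x * e x y = 0
  abs_deviation_le : ∀ x y, |e x y| ≤ θ

/-- The variance of the deviation `e` of a channel at the output `y`, over the inputs. -/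
def deviationVar (p : X → ℝ) (e : X → Y → ℝ) (y : Y) : ℝ :=
  ∑ x, p x * e x y ^ 2

/-- The `χ²`-information of a channel with deviation `e`: the `χ²`-divergence of the joint law of
input and output from the product of its marginals. To leading order it is twice the mutual
information. -/
def chiSqInfo (p : X → ℝ) (q : Y → ℝ) (e : X → Y → ℝ) : ℝ :=
  ∑ y, q y * deviationVar p e y

/-- The `a`-th moment of the likelihood ratio `1 + e` of a channel at the output `y`. -/
def powMean (p : X → ℝ) (e : X → Y → ℝ) (a : ℝ) (y : Y) : ℝ :=
  ∑ x, p x * (1 + e x y) ^ a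

theorem IsVeryNoisy.exists_isCentered {W : X → Y → ℝ} {η : ℝ} (hη : η ≤ 1 / 2)
    (hW : IsVeryNoisy η W) {p : X → ℝ} (hp : p ∈ stdSimplex ℝ X) :
    ∃ q e, IsCentered W p q e (4 * η) := by
  obtain ⟨ω, ε, hω, hω1, hsum, hε, hW⟩ := hW
  set m : Y → ℝ := fun y => ∑ x, p x * ε y x with hm
  have hm_le : ∀ y, |m y| ≤ η := fun y => abs_le.2
    ⟨le_sum_mul_of_mem_stdSimplex hp fun x => (abs_le.1 (hε y x)).1,
      sum_mul_le_of_mem_stdSimplex hp fun x => (abs_le.1 (hε y x)).2⟩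
  have hpos : ∀ y, 0 < 1 + m y := fun y => by linarith [(abs_le.1 (hm_le y)).1]
  have hω_m : ∑ y, ω y * m y = 0 := by
    simp only [hm, Finset.mul_sum, mul_left_comm (ω _)]
    rw [Finset.sum_comm]
    simp only [← Finset.mul_sum, hsum, mul_zero, Finset.sum_const_zero]
  refine ⟨fun y => ω y * (1 + m y), fun x y => (ε y x - m y) / (1 + m y), hp,
    ⟨fun y => mul_nonneg (hω y) (hpos y).le, ?_⟩, ?_, ?_, ?_, ?_⟩
  · simp only [mul_add, mul_one, Finset.sum_add_distrib, hω1, hω_m, add_zero]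
  · intro x y
    rw [hW, mul_assoc, mul_one_add (1 + m y), mul_div_cancel₀ _ (hpos y).ne']
    ring
  · intro x
    have hcancel : ∀ y, ω y * (1 + m y) * ((ε y x - m y) / (1 + m y))
        = ω y * ε y x - ω y * m y := fun y => by
      rw [mul_assoc, mul_div_cancel₀ _ (hpos y).ne', mul_sub]
    simp only [hcancel, Finset.sum_sub_distrib, hsum, hω_m, sub_zero]
  · intro y
    simp only [mul_div_assoc', ← Finset.sum_div, mul_sub, Finset.sum_sub_distrib, ← Finset.sum_mul,
      hp.2, one_mul]
    simp only [hm, sub_self, zero_div]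
  · intro x y
    obtain ⟨hε₁, hε₂⟩ := abs_le.1 (hε y x)
    obtain ⟨hm₁, hm₂⟩ := abs_le.1 (hm_le y)
    rw [abs_div, abs_of_pos (hpos y), div_le_iff₀ (hpos y), abs_le]
    constructor <;> nlinarith

theorem Ex_le_sum_neg_log {W : X → Y → ℝ} {p : X → ℝ} (hp : p ∈ stdSimplex ℝ X) {s ρ : ℝ}
    (hρ : 0 < ρ) (hpos : ∀ x x₁, 0 < ∑ y, W x y ^ (1 - s) * W x₁ y ^ s) :
    Ex W s ρ p ≤
      ∑ x, ∑ x₁, p x * p x₁ * -Real.log (∑ y, W x y ^ (1 - s) * W x₁ y ^ s) := by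
  have hpair : (fun i : X × X => p i.1 * p i.2) ∈ stdSimplex ℝ (X × X) := by
    refine ⟨fun i => mul_nonneg (hp.1 _) (hp.1 _), ?_⟩
    rw [Fintype.sum_prod_type]
    simp only [← Finset.mul_sum, hp.2, mul_one]
  have hjensen := sum_mul_log_le hpair
    (z := fun i => (∑ y, W i.1 y ^ (1 - s) * W i.2 y ^ s) ^ (1 / ρ))
    fun i => Real.rpow_pos_of_pos (hpos i.1 i.2) _
  simp only [Fintype.sum_prod_type, Real.log_rpow (hpos _ _), mul_left_comm _ (1 / ρ),
    ← Finset.mul_sum] at hjensen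
  have := mul_le_mul_of_nonneg_left hjensen hρ.le
  rw [← mul_assoc, mul_one_div_cancel hρ.ne', one_mul] at this
  simp only [Ex, mul_neg, Finset.sum_neg_distrib, neg_mul]
  exact neg_le_neg this

namespace IsCentered

variable {W : X → Y → ℝ} {p : X → ℝ} {q : Y → ℝ} {e : X → Y → ℝ} {θ : ℝ}

theorem bound_nonneg (h : IsCentered W p q e θ) : 0 ≤ θ := by
  obtain ⟨x, -⟩ :=
    Finset.exists_ne_zero_of_sum_ne_zero (ne_of_eq_of_ne h.input_mem.2 (one_ne_zero (α := ℝ)))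
  obtain ⟨y, -⟩ :=
    Finset.exists_ne_zero_of_sum_ne_zero (ne_of_eq_of_ne h.output_mem.2 (one_ne_zero (α := ℝ)))
  exact (abs_nonneg _).trans (h.abs_deviation_le x y)

theorem one_sub_le (h : IsCentered W p q e θ) (x : X) (y : Y) : 1 - θ ≤ 1 + e x y := by
  linarith [(abs_le.1 (h.abs_deviation_le x y)).1]

theorem one_add_pos (h : IsCentered W p q e θ) (hθ : θ < 1) (x : X) (y : Y) : 0 < 1 + e x y := by
  linarith [h.one_sub_le x y]

theorem sum_channel_eq_one (h : IsCentered W p q e θ) (x : X) : ∑ y, W x y = 1 := by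
  simp only [h.eq, mul_add, mul_one, Finset.sum_add_distrib, h.sum_output, h.output_mem.2, add_zero]

theorem channel_mem (h : IsCentered W p q e θ) (hθ : θ < 1) (x : X) : W x ∈ stdSimplex ℝ Y :=
  ⟨fun y => h.eq x y ▸ mul_nonneg (h.output_mem.1 y) (h.one_add_pos hθ x y).le,
    h.sum_channel_eq_one x⟩

theorem channel_le_exp_mul (h : IsCentered W p q e θ) (hθ : θ ≤ 1 / 4) (x x' : X) (y : Y) :
    W x y ≤ Real.exp 1 * W x' y := by
  rw [h.eq, h.eq, mul_left_comm]
  refine mul_le_mul_of_nonneg_left ?_ (h.output_mem.1 y)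
  calc 1 + e x y ≤ 2 * (1 + e x' y) := by
        linarith [le_of_abs_le (h.abs_deviation_le x y), h.one_sub_le x' y]
    _ ≤ Real.exp 1 * (1 + e x' y) :=
        mul_le_mul_of_nonneg_right (by linarith [Real.add_one_le_exp 1])
          (h.one_add_pos (by linarith) x' y).le

theorem sum_quadratic (h : IsCentered W p q e θ) (c a k : ℝ) (y : Y) :
    ∑ x, p x * (c + a * e x y + k * e x y ^ 2) = c + k * deviationVar p e y := by
  simp only [mul_add, mul_left_comm (p _), Finset.sum_add_distrib, ← Finset.mul_sum, h.sum_input,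
    mul_zero, add_zero, mul_comm (p _) c, h.input_mem.2, mul_one, deviationVar]

theorem output_eq (h : IsCentered W p q e θ) (y : Y) : ∑ x, p x * W x y = q y := by
  have := h.sum_quadratic 1 1 0 y
  simp only [one_mul, zero_mul, add_zero] at this
  simp only [h.eq, mul_left_comm (p _), ← Finset.mul_sum, this, mul_one]

theorem deviationVar_nonneg (h : IsCentered W p q e θ) (y : Y) : 0 ≤ deviationVar p e y :=
  le_sum_mul_of_mem_stdSimplex h.input_mem fun _ => sq_nonneg _

theorem deviationVar_le (h : IsCentered W p q e θ) (y : Y) : deviationVar p e y ≤ θ ^ 2 :=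
  sum_mul_le_of_mem_stdSimplex h.input_mem fun x =>
    sq_le_sq' (abs_le.1 (h.abs_deviation_le x y)).1 (abs_le.1 (h.abs_deviation_le x y)).2

theorem chiSqInfo_nonneg (h : IsCentered W p q e θ) : 0 ≤ chiSqInfo p q e :=
  le_sum_mul_of_mem_stdSimplex h.output_mem h.deviationVar_nonneg

theorem chiSqInfo_le (h : IsCentered W p q e θ) : chiSqInfo p q e ≤ θ ^ 2 :=
  sum_mul_le_of_mem_stdSimplex h.output_mem h.deviationVar_le

theorem mutualInfo_eq (h : IsCentered W p q e θ) :
    mutualInfo W p = ∑ y, q y * ∑ x, p x * ((1 + e x y) * Real.log (1 + e x y)) := by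
  simp only [mutualInfo, h.output_eq]
  rw [Finset.sum_comm]
  refine Finset.sum_congr rfl fun y _ => ?_
  rw [Finset.mul_sum]
  refine Finset.sum_congr rfl fun x _ => ?_
  rcases eq_or_ne (q y) 0 with hq | hq
  · simp [h.eq, hq]
  · rw [h.eq, mul_div_cancel_left₀ _ hq]
    ring

theorem le_mutualInfo (h : IsCentered W p q e θ) (hθ : θ ≤ 1 / 4) :
    (1 - 4 * θ) / 2 * chiSqInfo p q e ≤ mutualInfo W p := by
  rw [h.mutualInfo_eq, chiSqInfo, Finset.mul_sum]
  refine Finset.sum_le_sum fun y _ => ?_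
  rw [mul_left_comm, ← zero_add (_ * deviationVar p e y), ← h.sum_quadratic 0 1]
  simp only [zero_add, one_mul]
  exact mul_le_mul_of_nonneg_left (Finset.sum_le_sum fun x _ => mul_le_mul_of_nonneg_left
    (one_add_mul_log_bounds hθ (h.abs_deviation_le x y)).1 (h.input_mem.1 x)) (h.output_mem.1 y)

theorem mutualInfo_le (h : IsCentered W p q e θ) (hθ : θ ≤ 1 / 4) :
    mutualInfo W p ≤ (1 + 4 * θ) / 2 * chiSqInfo p q e := by
  rw [h.mutualInfo_eq, chiSqInfo, Finset.mul_sum]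
  refine Finset.sum_le_sum fun y _ => ?_
  rw [mul_left_comm, ← zero_add (_ * deviationVar p e y), ← h.sum_quadratic 0 1]
  simp only [zero_add, one_mul]
  exact mul_le_mul_of_nonneg_left (Finset.sum_le_sum fun x _ => mul_le_mul_of_nonneg_left
    (one_add_mul_log_bounds hθ (h.abs_deviation_le x y)).2 (h.input_mem.1 x)) (h.output_mem.1 y)

theorem powMean_bounds (h : IsCentered W p q e θ) (hθ : θ ≤ 1 / 4) {a : ℝ} (ha : 0 ≤ a)
    (ha1 : a ≤ 1) (y : Y) :
    1 - a * (1 - a) * (1 + 4 * θ) / 2 * deviationVar p e y ≤ powMean p e a y ∧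
      powMean p e a y ≤ 1 - a * (1 - a) * (1 - 4 * θ) / 2 * deviationVar p e y := by
  have hbounds := fun x => one_add_rpow_bounds ha ha1 hθ (h.abs_deviation_le x y)
  constructor
  · calc _ = ∑ x, p x * (1 + a * e x y + -(a * (1 - a) * (1 + 4 * θ) / 2) * e x y ^ 2) := by
          rw [h.sum_quadratic]
          ring
      _ ≤ powMean p e a y := Finset.sum_le_sum fun x _ =>
          mul_le_mul_of_nonneg_left (by linarith [(hbounds x).1]) (h.input_mem.1 x)
  · calc powMean p e a y
        ≤ ∑ x, p x * (1 + a * e x y + -(a * (1 - a) * (1 - 4 * θ) / 2) * e x y ^ 2) :=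
          Finset.sum_le_sum fun x _ =>
            mul_le_mul_of_nonneg_left (by linarith [(hbounds x).2]) (h.input_mem.1 x)
      _ = _ := by
          rw [h.sum_quadratic]
          ring

theorem one_sub_le_powMean (h : IsCentered W p q e θ) (hθ : θ < 1) {a : ℝ} (ha : 0 ≤ a)
    (ha1 : a ≤ 1) (y : Y) : 1 - θ ≤ powMean p e a y :=
  le_sum_mul_of_mem_stdSimplex h.input_mem fun x =>
    calc 1 - θ = (1 - θ) ^ (1 : ℝ) := (Real.rpow_one _).symm
      _ ≤ (1 - θ) ^ a := Real.rpow_le_rpow_of_exponent_ge (sub_pos.2 hθ)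
          (by linarith [h.bound_nonneg]) ha1
      _ ≤ (1 + e x y) ^ a := Real.rpow_le_rpow (sub_pos.2 hθ).le (h.one_sub_le x y) ha

theorem powMean_pos (h : IsCentered W p q e θ) (hθ : θ < 1) (a : ℝ) (y : Y) :
    0 < powMean p e a y :=
  sum_mul_pos h.input_mem fun x => Real.rpow_pos_of_pos (h.one_add_pos hθ x y) a

theorem powMean_le_one (h : IsCentered W p q e θ) (hθ : θ < 1) {a : ℝ} (ha : 0 ≤ a) (ha1 : a ≤ 1)
    (y : Y) : powMean p e a y ≤ 1 := by
  have hbernoulli := fun x => rpow_one_add_le_one_add_mul_self (s := e x y) (by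
    linarith [h.one_add_pos hθ x y]) ha ha1
  have := h.sum_quadratic 1 a 0 y
  simp only [zero_mul, add_zero] at this
  rw [← this]
  exact Finset.sum_le_sum fun x _ => mul_le_mul_of_nonneg_left (hbernoulli x) (h.input_mem.1 x)

theorem neg_log_powMean_le (h : IsCentered W p q e θ) (hθ : θ ≤ 1 / 4) {a : ℝ} (ha : 0 ≤ a)
    (ha1 : a ≤ 1) (y : Y) :
    -Real.log (powMean p e a y) ≤ (1 + 8 * θ) * (a * (1 - a)) / 2 * deviationVar p e y := by
  have hθ0 := h.bound_nonneg
  have hvar : 0 ≤ a * (1 - a) / 2 * deviationVar p e y :=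
    mul_nonneg (div_nonneg (mul_nonneg ha (by linarith)) zero_le_two) (h.deviationVar_nonneg y)
  calc -Real.log (powMean p e a y) ≤ (1 + 2 * θ) * (1 - powMean p e a y) :=
        neg_log_le_mul_one_sub (by linarith) (h.one_sub_le_powMean (by linarith) ha ha1 y)
          (h.powMean_le_one (by linarith) ha ha1 y)
    _ ≤ (1 + 2 * θ) * (a * (1 - a) * (1 + 4 * θ) / 2 * deviationVar p e y) := by
        gcongr
        linarith [(h.powMean_bounds hθ ha ha1 y).1]
    _ = (1 + 2 * θ) * (1 + 4 * θ) * (a * (1 - a) / 2 * deviationVar p e y) := by ring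
    _ ≤ (1 + 8 * θ) * (a * (1 - a) / 2 * deviationVar p e y) := by
        gcongr
        nlinarith
    _ = _ := by ring

theorem sum_mul_rpow_eq (h : IsCentered W p q e θ) (hθ : θ < 1) (a : ℝ) (y : Y) :
    ∑ x, p x * W x y ^ a = q y ^ a * powMean p e a y := by
  simp only [h.eq, Real.mul_rpow (h.output_mem.1 y) (h.one_add_pos hθ _ y).le,
    mul_left_comm (p _), ← Finset.mul_sum, powMean]

theorem Eo_eq (h : IsCentered W p q e θ) (hθ : θ < 1) {s ρ : ℝ} (hs : 0 ≤ s) (hsρ : s ≤ ρ) :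
    Eo W s ρ p =
      -Real.log (∑ y, q y * (powMean p e (1 - s) y * powMean p e (s / ρ) y ^ ρ)) := by
  have hρ : ρ = 0 → s = 0 := fun h0 => le_antisymm (h0 ▸ hsρ) hs
  rw [Eo]
  congr 2
  refine Finset.sum_congr rfl fun y _ => ?_
  have hq := h.output_mem.1 y
  rw [h.sum_mul_rpow_eq hθ, h.sum_mul_rpow_eq hθ,
    Real.mul_rpow (Real.rpow_nonneg hq _) (h.powMean_pos hθ _ y).le, ← Real.rpow_mul hq,
    mul_comm (s / ρ), mul_div_cancel_of_imp' hρ, mul_mul_mul_comm, rpow_one_sub_mul_rpow hq]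

theorem Eo_le (h : IsCentered W p q e θ) (hθ : θ ≤ 1 / 4) {s ρ : ℝ} (hs : 0 ≤ s) (hsρ : s ≤ ρ)
    (hρ : ρ ≤ 1) : Eo W s ρ p ≤ (1 + 8 * θ) * (s * (2 - s - s / ρ)) / 2 * chiSqInfo p q e := by
  have hθ1 : θ < 1 := by linarith
  have hρ0 : 0 ≤ ρ := hs.trans hsρ
  have hρs : ρ * (s / ρ) = s := mul_div_cancel_of_imp' fun h0 => le_antisymm (h0 ▸ hsρ) hs
  have hpos := h.powMean_pos hθ1
  rw [h.Eo_eq hθ1 hs hsρ, chiSqInfo, Finset.mul_sum]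
  refine (neg_le_neg (sum_mul_log_le h.output_mem fun y =>
    mul_pos (hpos _ y) (Real.rpow_pos_of_pos (hpos _ y) _))).trans ?_
  rw [← Finset.sum_neg_distrib]
  refine Finset.sum_le_sum fun y _ => ?_
  rw [Real.log_mul (hpos _ y).ne' (Real.rpow_pos_of_pos (hpos _ y) _).ne',
    Real.log_rpow (hpos _ y), ← mul_neg, mul_left_comm]
  refine mul_le_mul_of_nonneg_left ?_ (h.output_mem.1 y)
  have hfirst := h.neg_log_powMean_le hθ (a := 1 - s) (by linarith) (by linarith) y
  have hsecond := mul_le_mul_of_nonneg_left (h.neg_log_powMean_le hθ (div_nonneg hs hρ0)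
    (div_le_one_of_le₀ hsρ hρ0) y) hρ0
  calc _ = -Real.log (powMean p e (1 - s) y) + ρ * -Real.log (powMean p e (s / ρ) y) := by ring
    _ ≤ _ := add_le_add hfirst hsecond
    _ = (1 + 8 * θ) * (s * (1 - s) + ρ * (s / ρ) * (1 - s / ρ)) / 2 * deviationVar p e y := by ring
    _ = _ := by rw [hρs]; ring

theorem powMean_mul_powMean_rpow_le (h : IsCentered W p q e θ) (hθ : θ ≤ 1 / 4) {s ρ : ℝ}
    (hs : 0 ≤ s) (hsρ : s ≤ ρ) (hρ : ρ ≤ 1) (y : Y) :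
    powMean p e (1 - s) y * powMean p e (s / ρ) y ^ ρ ≤
      1 - (1 - 5 * θ) * (s * (2 - s - s / ρ)) / 2 * deviationVar p e y := by
  have hρ0 : 0 ≤ ρ := hs.trans hsρ
  have hρs : ρ * (s / ρ) = s := mul_div_cancel_of_imp' fun h0 => le_antisymm (h0 ▸ hsρ) hs
  have hu1 : s / ρ ≤ 1 := div_le_one_of_le₀ hsρ hρ0
  have hs1 : 0 ≤ 1 - s := by linarith
  have hV := h.deviationVar_nonneg y
  have hpos := h.powMean_pos (by linarith)
  have hκ : 0 ≤ 1 - 4 * θ := by linarith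
  set A := s * (1 - s) * (1 - 4 * θ) / 2 * deviationVar p e y with hA_def
  set B := s * (1 - s / ρ) * (1 - 4 * θ) / 2 * deviationVar p e y with hB_def
  have hA : powMean p e (1 - s) y ≤ 1 - A := by
    refine (h.powMean_bounds hθ hs1 (by linarith) y).2.trans (le_of_eq ?_)
    rw [hA_def]
    ring
  have hB : powMean p e (s / ρ) y ^ ρ ≤ 1 - B := by
    have hbernoulli := rpow_one_add_le_one_add_mul_self
      (s := powMean p e (s / ρ) y - 1) (by linarith [hpos (s / ρ) y]) hρ0 hρ
    rw [add_sub_cancel] at hbernoulli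
    refine hbernoulli.trans ?_
    have := mul_le_mul_of_nonneg_left
      (h.powMean_bounds hθ (div_nonneg hs hρ0) hu1 y).2 hρ0
    linear_combination this - (1 - s / ρ) * (1 - 4 * θ) / 2 * deviationVar p e y * hρs
  have hA0 : 0 ≤ A := by positivity
  have hB0 : 0 ≤ B := by
    have : 0 ≤ 1 - s / ρ := by linarith
    positivity
  have hAθ : A ≤ θ := by
    linarith [h.one_sub_le_powMean (by linarith) hs1 (by linarith) y]
  calc _ ≤ (1 - A) * (1 - B) :=
        mul_le_mul hA hB (Real.rpow_nonneg (hpos _ y).le _) (by linarith)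
    _ ≤ 1 - (1 - θ) * (A + B) := by nlinarith
    _ = 1 - (1 - θ) * (1 - 4 * θ) * (s * (2 - s - s / ρ) / 2 * deviationVar p e y) := by
        rw [hA_def, hB_def]
        ring
    _ ≤ 1 - (1 - 5 * θ) * (s * (2 - s - s / ρ) / 2 * deviationVar p e y) := by
        have : 0 ≤ s * (2 - s - s / ρ) := mul_nonneg hs (by linarith)
        gcongr
        nlinarith [sq_nonneg θ]
    _ = _ := by ring

theorem le_Eo (h : IsCentered W p q e θ) (hθ : θ ≤ 1 / 4) {s ρ : ℝ} (hs : 0 ≤ s) (hsρ : s ≤ ρ)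
    (hρ : ρ ≤ 1) : (1 - 5 * θ) * (s * (2 - s - s / ρ)) / 2 * chiSqInfo p q e ≤ Eo W s ρ p := by
  have hθ1 : θ < 1 := by linarith
  rw [h.Eo_eq hθ1 hs hsρ]
  set S := ∑ y, q y * (powMean p e (1 - s) y * powMean p e (s / ρ) y ^ ρ)
  have hlog : Real.log S ≤ S - 1 := Real.log_le_sub_one_of_pos <| sum_mul_pos h.output_mem fun y =>
    mul_pos (h.powMean_pos hθ1 _ y) (Real.rpow_pos_of_pos (h.powMean_pos hθ1 _ y) _)
  suffices hS : S ≤ 1 - (1 - 5 * θ) * (s * (2 - s - s / ρ)) / 2 * chiSqInfo p q e by linarith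
  calc S ≤ ∑ y, q y * (1 - (1 - 5 * θ) * (s * (2 - s - s / ρ)) / 2 * deviationVar p e y) :=
        Finset.sum_le_sum fun y _ => mul_le_mul_of_nonneg_left
          (h.powMean_mul_powMean_rpow_le hθ hs hsρ hρ y) (h.output_mem.1 y)
    _ = _ := by
        simp only [mul_sub, mul_one, Finset.sum_sub_distrib, h.output_mem.2, mul_left_comm (q _),
          ← Finset.mul_sum, chiSqInfo]

theorem one_sub_le_sum_rpow_mul_rpow (h : IsCentered W p q e θ) (hθ : θ ≤ 1) {s : ℝ} (hs : 0 ≤ s)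
    (hs1 : s ≤ 1) (x x₁ : X) : 1 - θ ≤ ∑ y, W x y ^ (1 - s) * W x₁ y ^ s := by
  have hle : ∀ x y, q y * (1 - θ) ≤ W x y := fun x y => by
    rw [h.eq]
    exact mul_le_mul_of_nonneg_left (h.one_sub_le x y) (h.output_mem.1 y)
  have hnonneg : ∀ y, 0 ≤ q y * (1 - θ) := fun y =>
    mul_nonneg (h.output_mem.1 y) (sub_nonneg.2 hθ)
  calc 1 - θ = ∑ y, q y * (1 - θ) := by rw [← Finset.sum_mul, h.output_mem.2, one_mul]
    _ = ∑ y, (q y * (1 - θ)) ^ (1 - s) * (q y * (1 - θ)) ^ s :=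
        Finset.sum_congr rfl fun y _ => (rpow_one_sub_mul_rpow (hnonneg y) s).symm
    _ ≤ _ := Finset.sum_le_sum fun y _ => mul_le_mul
        (Real.rpow_le_rpow (hnonneg y) (hle x y) (by linarith))
        (Real.rpow_le_rpow (hnonneg y) (hle x₁ y) hs) (Real.rpow_nonneg (hnonneg y) _)
        (Real.rpow_nonneg ((hnonneg y).trans (hle x y)) _)

theorem sum_rpow_mul_rpow_le_one (h : IsCentered W p q e θ) (hθ : θ < 1) {s : ℝ} (hs : 0 ≤ s)
    (hs1 : s ≤ 1) (x x₁ : X) : ∑ y, W x y ^ (1 - s) * W x₁ y ^ s ≤ 1 := by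
  have hW : ∀ x y, 0 ≤ W x y := fun x y => by
    rw [h.eq]
    exact mul_nonneg (h.output_mem.1 y) (h.one_add_pos hθ x y).le
  calc _ ≤ ∑ y, ((1 - s) * W x y + s * W x₁ y) := Finset.sum_le_sum fun y _ =>
        Real.geom_mean_le_arith_mean2_weighted (by linarith) hs (hW x y) (hW x₁ y) (by ring)
    _ = 1 := by
        rw [Finset.sum_add_distrib, ← Finset.mul_sum, ← Finset.mul_sum, h.sum_channel_eq_one,
          h.sum_channel_eq_one]
        ring

theorem le_sum_sum_rpow_mul_rpow (h : IsCentered W p q e θ) (hθ : θ ≤ 1 / 4) {s : ℝ}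
    (hs : 0 ≤ s) (hs1 : s ≤ 1) :
    1 - s * (1 - s) * (1 + 4 * θ) * chiSqInfo p q e ≤
      ∑ x, ∑ x₁, p x * p x₁ * ∑ y, W x y ^ (1 - s) * W x₁ y ^ s := by
  have hθ1 : θ < 1 := by linarith
  have hs' : 0 ≤ 1 - s := by linarith
  have hfactor : ∑ x, ∑ x₁, p x * p x₁ * ∑ y, W x y ^ (1 - s) * W x₁ y ^ s
      = ∑ y, q y * (powMean p e (1 - s) y * powMean p e s y) := by
    calc _ = ∑ y, (∑ x, p x * W x y ^ (1 - s)) * ∑ x₁, p x₁ * W x₁ y ^ s := by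
          simp only [Finset.sum_mul_sum]
          simp only [Finset.mul_sum, mul_mul_mul_comm (p _)]
          exact (Finset.sum_congr rfl fun x _ => Finset.sum_comm).trans Finset.sum_comm
      _ = _ := Finset.sum_congr rfl fun y _ => by
          rw [h.sum_mul_rpow_eq hθ1, h.sum_mul_rpow_eq hθ1, mul_mul_mul_comm,
            rpow_one_sub_mul_rpow (h.output_mem.1 y)]
  have hprod : ∀ y, 1 - s * (1 - s) * (1 + 4 * θ) * deviationVar p e y ≤
      powMean p e (1 - s) y * powMean p e s y := fun y => by
    have ha := (h.powMean_bounds hθ hs' (by linarith) y).1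
    have hb := (h.powMean_bounds hθ hs hs1 y).1
    nlinarith [mul_nonneg (sub_nonneg.2 (h.powMean_le_one hθ1 hs' (by linarith) y))
      (sub_nonneg.2 (h.powMean_le_one hθ1 hs hs1 y))]
  rw [hfactor]
  calc _ = ∑ y, q y * (1 - s * (1 - s) * (1 + 4 * θ) * deviationVar p e y) := by
        simp only [mul_sub, mul_one, Finset.sum_sub_distrib, h.output_mem.2, mul_left_comm (q _),
          ← Finset.mul_sum, chiSqInfo]
    _ ≤ _ := Finset.sum_le_sum fun y _ => mul_le_mul_of_nonneg_left (hprod y) (h.output_mem.1 y)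

theorem Ex_le (h : IsCentered W p q e θ) (hθ : θ ≤ 1 / 4) {s ρ : ℝ} (hs : 0 ≤ s) (hs1 : s ≤ 1)
    (hρ : 0 < ρ) : Ex W s ρ p ≤ (1 + 8 * θ) * (s * (1 - s)) * chiSqInfo p q e := by
  have hθ0 := h.bound_nonneg
  set H : X → X → ℝ := fun x x₁ => ∑ y, W x y ^ (1 - s) * W x₁ y ^ s
  have hH : ∀ x x₁, 1 - θ ≤ H x x₁ := h.one_sub_le_sum_rpow_mul_rpow (by linarith) hs hs1
  have hcompl : ∑ x, ∑ x₁, p x * p x₁ * (1 - H x x₁) = 1 - ∑ x, ∑ x₁, p x * p x₁ * H x x₁ := by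
    simp only [mul_one_sub, Finset.sum_sub_distrib, ← Finset.mul_sum, h.input_mem.2, mul_one]
  calc Ex W s ρ p ≤ ∑ x, ∑ x₁, p x * p x₁ * -Real.log (H x x₁) :=
        Ex_le_sum_neg_log h.input_mem hρ fun x x₁ => by linarith [hH x x₁]
    _ ≤ ∑ x, ∑ x₁, p x * p x₁ * ((1 + 2 * θ) * (1 - H x x₁)) :=
        Finset.sum_le_sum fun x _ => Finset.sum_le_sum fun x₁ _ => mul_le_mul_of_nonneg_left
          (neg_log_le_mul_one_sub (by linarith) (hH x x₁)
            (h.sum_rpow_mul_rpow_le_one (by linarith) hs hs1 x x₁))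
          (mul_nonneg (h.input_mem.1 x) (h.input_mem.1 x₁))
    _ = (1 + 2 * θ) * (1 - ∑ x, ∑ x₁, p x * p x₁ * H x x₁) := by
        rw [← hcompl]
        simp only [mul_left_comm _ (1 + 2 * θ), ← Finset.mul_sum]
    _ ≤ (1 + 2 * θ) * (s * (1 - s) * (1 + 4 * θ) * chiSqInfo p q e) := by
        gcongr
        linarith [h.le_sum_sum_rpow_mul_rpow hθ hs hs1]
    _ = (1 + 2 * θ) * (1 + 4 * θ) * (s * (1 - s) * chiSqInfo p q e) := by ring
    _ ≤ (1 + 8 * θ) * (s * (1 - s) * chiSqInfo p q e) := by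
        have : 0 ≤ s * (1 - s) * chiSqInfo p q e :=
          mul_nonneg (mul_nonneg hs (by linarith)) h.chiSqInfo_nonneg
        gcongr
        nlinarith
    _ = _ := by ring

end IsCentered

end Centered

/-! ### The feedback exponent -/

/-- The feedback exponent at rate `R` of the very noisy channel of capacity `C`, to leading order in
the noise level. -/
def veryNoisyExponent (C R : ℝ) : ℝ :=
  (C - R) + (√C - √R) ^ 2

theorem veryNoisyExponent_nonneg {C R : ℝ} (hRC : R ≤ C) : 0 ≤ veryNoisyExponent C R :=
  add_nonneg (sub_nonneg.2 hRC) (sq_nonneg _)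

theorem veryNoisyExponent_eq {C R : ℝ} (hC : 0 ≤ C) (hR : 0 ≤ R) :
    veryNoisyExponent C R = 2 * C - 2 * (√C * √R) := by
  rw [veryNoisyExponent, sub_sq, Real.sq_sqrt hC, Real.sq_sqrt hR]
  ring

theorem sub_le_mul_veryNoisyExponent {C R s ρ : ℝ} (hC : 0 ≤ C) (hR : 0 ≤ R) (hs : 0 ≤ s)
    (hsρ : s ≤ ρ) : s * (2 - s / ρ) * C - ρ * R ≤ s * veryNoisyExponent C R := by
  have hρ : ρ * (s / ρ) = s := mul_div_cancel_of_imp' fun h0 => le_antisymm (h0 ▸ hsρ) hs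
  have hsq : 0 ≤ ρ * (√R - s / ρ * √C) ^ 2 := mul_nonneg (hs.trans hsρ) (sq_nonneg _)
  rw [veryNoisyExponent_eq hC hR]
  linear_combination hsq - (2 * (√C * √R) - s / ρ * C) * hρ + ρ * Real.sq_sqrt hR
    + ρ * (s / ρ) ^ 2 * Real.sq_sqrt hC

-- The bound `sub_le_mul_veryNoisyExponent` is tight at `s = ρ * √(R / C)`; `ρ` has to be small,
-- since the term `-s ^ 2` of `s * (2 - s - s / ρ)` is missing there.
theorem exists_lt_mul_veryNoisyExponent {C R δ : ℝ} (hC : 0 < C) (hR : 0 ≤ R) (hRC : R ≤ C)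
    (hδ : 0 < δ) (hδ1 : δ ≤ 1 / 8) :
    ∃ s ρ : ℝ, 0 < s ∧ s < 1 ∧ s ≤ ρ ∧ ρ ≤ 1 ∧
      ρ * R + s * (veryNoisyExponent C R - 8 * δ * C) < (1 - δ) * (s * (2 - s - s / ρ)) * C := by
  have hC0 : 0 < √C := Real.sqrt_pos.2 hC
  have hRC' : √R ≤ √C := Real.sqrt_le_sqrt hRC
  have hCC : √C * √C = C := Real.mul_self_sqrt hC.le
  obtain ⟨w, hw0, hw1, hwR, hwC⟩ :
      ∃ w : ℝ, 0 < w ∧ w ≤ 1 ∧ √R ≤ w * √C ∧ w * √C ≤ √R + 2 * δ * √C := by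
    refine ⟨max (√R / √C) (2 * δ), lt_max_of_lt_right (by linarith),
      max_le ((div_le_one hC0).2 hRC') (by linarith), (div_le_iff₀ hC0).1 (le_max_left _ _), ?_⟩
    rw [max_mul_of_nonneg _ _ hC0.le, div_mul_cancel₀ _ hC0.ne']
    exact max_le (by nlinarith) (by linarith [Real.sqrt_nonneg R])
  have hρ0 : 0 < 2 * δ := by linarith
  refine ⟨w * (2 * δ), 2 * δ, by positivity, by nlinarith, by nlinarith, by linarith, ?_⟩
  rw [mul_div_cancel_right₀ _ hρ0.ne', veryNoisyExponent_eq hC.le hR]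
  have hR_le : R ≤ w * (√C * √R) := by
    nlinarith [Real.mul_self_sqrt hR, mul_le_mul_of_nonneg_right hwR (Real.sqrt_nonneg R)]
  have hwC_le : w * (w * C) ≤ w * (√C * √R + 2 * δ * C) := by
    refine mul_le_mul_of_nonneg_left ?_ hw0.le
    nlinarith [mul_le_mul_of_nonneg_right hwC hC0.le]
  have hslack : w * C * (2 - 4 * δ - w) ≤ w * C * ((1 - δ) * (2 - w * (2 * δ) - w)) := by
    refine mul_le_mul_of_nonneg_left ?_ (by positivity)
    nlinarith [mul_pos hw0 hδ, mul_pos hδ (mul_pos hw0 hδ)]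
  have hgap : 0 < w * C * δ := by positivity
  have hmain : R + w * (2 * C - 2 * (√C * √R) - 8 * δ * C) <
      (1 - δ) * (w * (2 - w * (2 * δ) - w)) * C := by linarith
  calc _ = 2 * δ * (R + w * (2 * C - 2 * (√C * √R) - 8 * δ * C)) := by ring
    _ < 2 * δ * ((1 - δ) * (w * (2 - w * (2 * δ) - w)) * C) := mul_lt_mul_of_pos_left hmain hρ0
    _ = _ := by ring

section Feedback

variable {X : Type u} {Y : Type v} [Fintype X] [Fintype Y] {W : X → Y → ℝ}

theorem IsVeryNoisy.mutualInfo_le_capacity {η : ℝ} (hη : η ≤ 1 / 16) (hW : IsVeryNoisy η W)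
    {p : X → ℝ} (hp : p ∈ stdSimplex ℝ X) : mutualInfo W p ≤ capacity W := by
  refine le_csSup ⟨1, ?_⟩ ⟨p, hp, rfl⟩
  rintro _ ⟨p', hp', rfl⟩
  obtain ⟨q, e, h⟩ := hW.exists_isCentered (by linarith) hp'
  have hθ0 := h.bound_nonneg
  have hχ : chiSqInfo p' q e ≤ 1 := h.chiSqInfo_le.trans (by nlinarith)
  calc mutualInfo W p' ≤ (1 + 4 * (4 * η)) / 2 * chiSqInfo p' q e := h.mutualInfo_le (by linarith)
    _ ≤ 1 * 1 := mul_le_mul (by linarith) hχ h.chiSqInfo_nonneg zero_le_one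
    _ = 1 := one_mul 1

/-- Up to the factors `1 ± δ`, the exponent functions of `W` are at most the leading-order exponent
functions of the very noisy channel with the same capacity, and the input distribution `p` attains
those of random coding. -/
structure HasNoisyExponents (W : X → Y → ℝ) (p : X → ℝ) (δ : ℝ) : Prop where
  mem : p ∈ stdSimplex ℝ X
  capacity_nonneg : 0 ≤ capacity W
  Eo_le : ∀ p ∈ stdSimplex ℝ X, ∀ s ρ : ℝ, 0 ≤ s → s ≤ ρ → ρ ≤ 1 →
    Eo W s ρ p ≤ (1 + δ) * (s * (2 - s - s / ρ)) * capacity W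
  Ex_le : ∀ p ∈ stdSimplex ℝ X, ∀ s ρ : ℝ, 0 ≤ s → s ≤ 1 → 1 ≤ ρ →
    Ex W s ρ p ≤ (1 + δ) * (2 * (s * (1 - s))) * capacity W
  le_Eo : ∀ s ρ : ℝ, 0 ≤ s → s ≤ ρ → ρ ≤ 1 →
    (1 - δ) * (s * (2 - s - s / ρ)) * capacity W ≤ Eo W s ρ p

theorem IsVeryNoisy.hasNoisyExponents {δ η : ℝ} (hδ1 : δ ≤ 1) (hη : η ≤ δ / 80)
    (hW : IsVeryNoisy η W) {p : X → ℝ} (hp : IsCapacityAchieving W p) :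
    HasNoisyExponents W p δ := by
  have chiSqInfo_le : ∀ p' ∈ stdSimplex ℝ X, ∃ q e, IsCentered W p' q e (4 * η) ∧
      (1 + 8 * (4 * η)) * (chiSqInfo p' q e / 2) ≤ (1 + δ) * capacity W := fun p' hp' => by
    obtain ⟨q, e, h⟩ := hW.exists_isCentered (by linarith) hp'
    have hη0 := h.bound_nonneg
    refine ⟨q, e, h, ?_⟩
    calc _ ≤ (1 + δ) * (1 - 4 * (4 * η)) * (chiSqInfo p' q e / 2) :=
          mul_le_mul_of_nonneg_right (by nlinarith) (div_nonneg h.chiSqInfo_nonneg zero_le_two)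
      _ = (1 + δ) * ((1 - 4 * (4 * η)) / 2 * chiSqInfo p' q e) := by ring
      _ ≤ (1 + δ) * capacity W := mul_le_mul_of_nonneg_left
          ((h.le_mutualInfo (by linarith)).trans (hW.mutualInfo_le_capacity (by linarith) hp'))
          (by linarith)
  obtain ⟨q, e, h⟩ := hW.exists_isCentered (by linarith) hp.1
  have hη0 := h.bound_nonneg
  have le_chiSqInfo : (1 - δ) * capacity W ≤ (1 - 5 * (4 * η)) * (chiSqInfo p q e / 2) :=
    calc _ ≤ (1 - δ) * ((1 + 4 * (4 * η)) / 2 * chiSqInfo p q e) :=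
          mul_le_mul_of_nonneg_left (hp.2 ▸ h.mutualInfo_le (by linarith)) (by linarith)
      _ = (1 - δ) * (1 + 4 * (4 * η)) * (chiSqInfo p q e / 2) := by ring
      _ ≤ _ := mul_le_mul_of_nonneg_right (by nlinarith)
          (div_nonneg h.chiSqInfo_nonneg zero_le_two)
  have hcoeff : ∀ {s ρ : ℝ}, 0 ≤ s → s ≤ ρ → ρ ≤ 1 → 0 ≤ s * (2 - s - s / ρ) :=
    fun hs hsρ hρ => mul_nonneg hs (by linarith [div_le_one_of_le₀ hsρ (hs.trans hsρ)])
  refine ⟨hp.1, ?_, fun p' hp' s ρ hs hsρ hρ => ?_, fun p' hp' s ρ hs hs1 hρ => ?_,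
    fun s ρ hs hsρ hρ => ?_⟩
  · rw [← hp.2]
    exact le_trans (mul_nonneg (by linarith) h.chiSqInfo_nonneg) (h.le_mutualInfo (by linarith))
  · obtain ⟨q', e', h', hχ⟩ := chiSqInfo_le p' hp'
    linear_combination h'.Eo_le (by linarith) hs hsρ hρ
      + mul_le_mul_of_nonneg_left hχ (hcoeff hs hsρ hρ)
  · obtain ⟨q', e', h', hχ⟩ := chiSqInfo_le p' hp'
    have hcoeff' : 0 ≤ 2 * (s * (1 - s)) :=
      mul_nonneg zero_le_two (mul_nonneg hs (sub_nonneg.2 hs1))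
    linear_combination h'.Ex_le (by linarith) hs hs1 (zero_lt_one.trans_le hρ)
      + mul_le_mul_of_nonneg_left hχ hcoeff'
  · linear_combination h.le_Eo (by linarith) hs hsρ hρ
      + mul_le_mul_of_nonneg_left le_chiSqInfo (hcoeff hs hsρ hρ)

namespace HasNoisyExponents

variable {p : X → ℝ} {δ R : ℝ}

theorem Eo_zero_zero (h : HasNoisyExponents W p δ) : Eo W 0 0 p = 0 :=
  le_antisymm (by simpa using h.Eo_le p h.mem 0 0 le_rfl le_rfl zero_le_one)
    (by simpa using h.le_Eo 0 0 le_rfl le_rfl zero_le_one)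

theorem Eo_sub_nonpos (h : HasNoisyExponents W p δ) (hδ : 0 ≤ δ) (hR : 0 ≤ R) {p' : X → ℝ}
    (hp' : p' ∈ stdSimplex ℝ X) {s ρ : ℝ} (hs : 0 ≤ s) (hsρ : s ≤ ρ) (hρ : ρ ≤ 1) :
    Eo W s ρ p' - ρ * R - s * (veryNoisyExponent (capacity W) R + 2 * δ * capacity W) ≤ 0 := by
  have hC := h.capacity_nonneg
  have hu : 0 ≤ s / ρ := div_nonneg hs (hs.trans hsρ)
  have hloss : 0 ≤ s * capacity W * (s + δ * (s + s / ρ)) := by positivity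
  linear_combination h.Eo_le p' hp' s ρ hs hsρ hρ + sub_le_mul_veryNoisyExponent hC hR hs hsρ
    + hloss

theorem Ex_sub_nonpos (h : HasNoisyExponents W p δ) (hδ : 0 ≤ δ) (hR : 0 ≤ R) {p' : X → ℝ}
    (hp' : p' ∈ stdSimplex ℝ X) {s ρ : ℝ} (hs : 0 ≤ s) (hs1 : s ≤ 1) (hρ : 1 ≤ ρ) :
    Ex W s ρ p' - ρ * R - s * (veryNoisyExponent (capacity W) R + 2 * δ * capacity W) ≤ 0 := by
  have hC := h.capacity_nonneg
  have hloss : 0 ≤ s ^ 2 * capacity W * (1 + 2 * δ) := by positivity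
  have hρR : R ≤ ρ * R := le_mul_of_one_le_left hR hρ
  have hρ_one := sub_le_mul_veryNoisyExponent hC hR hs hs1
  rw [div_one] at hρ_one
  linear_combination h.Ex_le p' hp' s ρ hs hs1 hρ + hρ_one + hρR + hloss

theorem E1_eq_zero (h : HasNoisyExponents W p δ) (hδ : 0 ≤ δ) (hR : 0 ≤ R) :
    E1 W R (veryNoisyExponent (capacity W) R + 2 * δ * capacity W) = 0 := by
  apply le_antisymm
  · refine sup_le (sSup_le ?_) (sSup_le ?_)
    · rintro _ ⟨s, ρ, p', hs, hsρ, hρ, hp', rfl⟩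
      exact_mod_cast h.Eo_sub_nonpos hδ hR hp' hs hsρ hρ
    · rintro _ ⟨s, ρ, p', hs, hs1, hρ, hp', rfl⟩
      exact_mod_cast h.Ex_sub_nonpos hδ hR hp' hs hs1 hρ
  · refine le_sup_of_le_left (le_sSup ⟨0, 0, p, le_rfl, le_rfl, zero_le_one, h.mem, ?_⟩)
    simp [h.Eo_zero_zero]

theorem feedbackExponent_le (h : HasNoisyExponents W p δ) (hδ : 0 ≤ δ) (hR : 0 ≤ R)
    (hRC : R ≤ capacity W) :
    feedbackExponent W R ≤
      ((veryNoisyExponent (capacity W) R + 2 * δ * capacity W : ℝ) : EReal) := by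
  have hC := h.capacity_nonneg
  exact sInf_le ⟨_, add_nonneg (veryNoisyExponent_nonneg hRC) (by positivity),
    h.E1_eq_zero hδ hR, rfl⟩

theorem le_feedbackExponent (h : HasNoisyExponents W p δ) (hδ : 0 < δ) (hδ1 : δ ≤ 1 / 8)
    (hR : 0 ≤ R) (hRC : R ≤ capacity W) :
    ((veryNoisyExponent (capacity W) R - 8 * δ * capacity W : ℝ) : EReal) ≤
      feedbackExponent W R := by
  refine le_sInf ?_
  rintro _ ⟨T, hT, hE, rfl⟩
  rw [EReal.coe_le_coe_iff]
  rcases h.capacity_nonneg.eq_or_lt with hC | hC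
  · obtain rfl : R = 0 := le_antisymm (hC ▸ hRC) hR
    simpa [← hC, veryNoisyExponent] using hT
  · obtain ⟨s, ρ, hs, -, hsρ, hρ, hlt⟩ := exists_lt_mul_veryNoisyExponent hC hR hRC hδ hδ1
    have hE1 : ((Eo W s ρ p - ρ * R - s * T : ℝ) : EReal) ≤ 0 :=
      hE ▸ le_sup_of_le_left (le_sSup ⟨s, ρ, p, hs.le, hsρ, hρ, h.mem, rfl⟩)
    have hEo : Eo W s ρ p - ρ * R - s * T ≤ 0 := by exact_mod_cast hE1
    have hsT : s * (veryNoisyExponent (capacity W) R - 8 * δ * capacity W) < s * T := by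
      linarith [h.le_Eo s ρ hs.le hsρ hρ]
    exact (lt_of_mul_lt_mul_left hsT hs.le).le

end HasNoisyExponents

end Feedback

/-! ### Random coding -/

section Products

variable {ι κ A B : Type*} [Fintype ι] [Fintype κ] [Fintype A] [Fintype B] [DecidableEq ι]

theorem sum_pi_pi_prod [DecidableEq κ] (f : ι → κ → A → ℝ) :
    ∑ a : ι → κ → A, ∏ i, ∏ j, f i j (a i j) = ∏ i, ∏ j, ∑ x, f i j x := by
  simp only [Fintype.prod_sum]

theorem sum_prod_mul_eq_sum_mul_sum (P : A → ℝ) (i₀ : ι) (F : A → ({i // i ≠ i₀} → A) → ℝ) :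
    ∑ c : ι → A, (∏ i, P (c i)) * F (c i₀) (fun j => c j) =
      ∑ a, P a * ∑ c : {i // i ≠ i₀} → A, (∏ j, P (c j)) * F a c := by
  rw [← (Equiv.funSplitAt i₀ A).symm.sum_comp, Fintype.sum_prod_type]
  refine Finset.sum_congr rfl fun a _ => ?_
  rw [Finset.mul_sum]
  refine Finset.sum_congr rfl fun c _ => ?_
  rw [Fintype.prod_eq_mul_prod_subtype_ne _ i₀, mul_assoc]
  simp [Equiv.funSplitAt, fun j : {i // i ≠ i₀} => j.2]

theorem prod_mem_stdSimplex {P : A → ℝ} (hP : P ∈ stdSimplex ℝ A) :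
    (fun c : ι → A => ∏ i, P (c i)) ∈ stdSimplex ℝ (ι → A) :=
  ⟨fun _ => Finset.prod_nonneg fun _ _ => hP.1 _, by simp [← Fintype.prod_sum, hP.2]⟩

theorem sum_prod_mul_apply {P : A → ℝ} (hP : P ∈ stdSimplex ℝ A) (g : A → ℝ) (i₀ : ι) :
    ∑ c : ι → A, (∏ i, P (c i)) * g (c i₀) = ∑ a, P a * g a := by
  rw [sum_prod_mul_eq_sum_mul_sum P i₀ fun a _ => g a]
  simp only [← Finset.sum_mul, (prod_mem_stdSimplex hP).2, one_mul]

theorem sum_prod_mul_sum_rpow_le {P g : A → ℝ} (hP : P ∈ stdSimplex ℝ A) (hg : ∀ a, 0 ≤ g a)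
    {ρ : ℝ} (hρ : 0 ≤ ρ) (hρ1 : ρ ≤ 1) :
    ∑ c : ι → A, (∏ i, P (c i)) * (∑ i, g (c i)) ^ ρ ≤
      (Fintype.card ι * ∑ a, P a * g a) ^ ρ := by
  have hmean : ∑ c : ι → A, (∏ i, P (c i)) * ∑ i, g (c i) = Fintype.card ι * ∑ a, P a * g a := by
    simp only [Finset.mul_sum]
    rw [Finset.sum_comm]
    simp only [sum_prod_mul_apply hP, Finset.sum_const, Finset.card_univ, nsmul_eq_mul,
      Finset.mul_sum]
  have hPι := prod_mem_stdSimplex (ι := ι) hP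
  simpa only [smul_eq_mul, hmean] using (Real.concaveOn_rpow hρ hρ1).le_map_sum
    (p := fun c : ι → A => ∑ i, g (c i)) (fun c _ => hPι.1 c) hPι.2
    fun c _ => Finset.sum_nonneg fun i _ => hg _

theorem sum_prod_mul_mul_sum_erase_rpow_le {P f g : A → ℝ} (hP : P ∈ stdSimplex ℝ A)
    (hf : ∀ a, 0 ≤ f a) (hg : ∀ a, 0 ≤ g a) {ρ : ℝ} (hρ : 0 ≤ ρ) (hρ1 : ρ ≤ 1) (i₀ : ι) :
    ∑ c : ι → A, (∏ i, P (c i)) * (f (c i₀) * (∑ i ∈ Finset.univ.erase i₀, g (c i)) ^ ρ) ≤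
      (∑ a, P a * f a) * (Fintype.card ι * ∑ a, P a * g a) ^ ρ := by
  have hEg : 0 ≤ ∑ a, P a * g a := Finset.sum_nonneg fun a _ => mul_nonneg (hP.1 a) (hg a)
  have herase : ∀ c : ι → A,
      ∑ i ∈ Finset.univ.erase i₀, g (c i) = ∑ j : {i // i ≠ i₀}, g (c j) := fun c =>
    Finset.sum_subtype _ (by simp) _
  have hcard : Fintype.card {i // i ≠ i₀} ≤ Fintype.card ι := Fintype.card_subtype_le _
  simp only [herase]
  rw [sum_prod_mul_eq_sum_mul_sum P i₀ fun a c => f a * (∑ j, g (c j)) ^ ρ, Finset.sum_mul]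
  refine Finset.sum_le_sum fun a _ => ?_
  calc P a * ∑ c : {i // i ≠ i₀} → A, (∏ j, P (c j)) * (f a * (∑ j, g (c j)) ^ ρ)
      = P a * f a * ∑ c : {i // i ≠ i₀} → A, (∏ j, P (c j)) * (∑ j, g (c j)) ^ ρ := by
        simp only [Finset.mul_sum]
        exact Finset.sum_congr rfl fun c _ => by ring
    _ ≤ P a * f a * (Fintype.card {i // i ≠ i₀} * ∑ a, P a * g a) ^ ρ :=
        mul_le_mul_of_nonneg_left (sum_prod_mul_sum_rpow_le hP hg hρ hρ1)
          (mul_nonneg (hP.1 a) (hf a))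
    _ ≤ P a * f a * (Fintype.card ι * ∑ a, P a * g a) ^ ρ := by
        have := mul_nonneg (hP.1 a) (hf a)
        gcongr

theorem sum_pi_pi_prod_mul_rpow [DecidableEq κ] {F H : ι → A → B → ℝ}
    (hH : ∀ i a b, 0 ≤ H i a b) (ρ : ℝ) :
    ∑ y : ι → κ → B, (∑ x : ι → κ → A, ∏ i, ∏ j, F i (x i j) (y i j)) *
        (∑ x : ι → κ → A, ∏ i, ∏ j, H i (x i j) (y i j)) ^ ρ =
      ∏ i, (∑ b, (∑ a, F i a b) * (∑ a, H i a b) ^ ρ) ^ Fintype.card κ := by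
  have hH' : ∀ i b, 0 ≤ ∑ a, H i a b := fun i b => Finset.sum_nonneg fun a _ => hH i a b
  have hterm : ∀ y : ι → κ → B, (∑ x : ι → κ → A, ∏ i, ∏ j, F i (x i j) (y i j)) *
      (∑ x : ι → κ → A, ∏ i, ∏ j, H i (x i j) (y i j)) ^ ρ =
      ∏ i, ∏ j, (∑ a, F i a (y i j)) * (∑ a, H i a (y i j)) ^ ρ := fun y => by
    rw [sum_pi_pi_prod fun i j a => F i a (y i j), sum_pi_pi_prod fun i j a => H i a (y i j)]
    simp only [Finset.prod_mul_distrib]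
    rw [← Real.finsetProd_rpow _ _ fun i _ => Finset.prod_nonneg fun j _ => hH' i _]
    simp only [Real.finsetProd_rpow _ _ fun _ _ => hH' _ _]
  simp only [hterm]
  rw [sum_pi_pi_prod fun i _ b => (∑ a, F i a b) * (∑ a, H i a b) ^ ρ]
  simp only [Finset.prod_const, Finset.card_univ]

theorem sum_prod_mul_restrict (s : Set ι) [DecidablePred (· ∈ s)] (w : ι → A → ℝ)
    (g : (s → A) → ℝ) :
    ∑ a : ι → A, (∏ i, w i (a i)) * g (s.domRestrict a) =
      (∏ i : {i // i ∉ s}, ∑ x, w i x) * ∑ b : s → A, (∏ i : s, w i (b i)) * g b := by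
  set e := Equiv.piEquivPiSubtypeProd (· ∈ s) fun _ => A
  have hmem : ∀ a i, (e.symm a) i.1 = a.1 i := fun a (i : {i // i ∈ s}) => dif_pos i.2
  have hnotMem : ∀ a i, (e.symm a) i.1 = a.2 i := fun a (i : {i // i ∉ s}) => dif_neg i.2
  have hrestrict : ∀ a, s.domRestrict (e.symm a) = a.1 := fun a => funext (hmem a)
  rw [← e.symm.sum_comp, Fintype.sum_prod_type, Fintype.prod_sum, Finset.sum_mul_sum,
    Finset.sum_comm]
  refine Finset.sum_congr rfl fun a _ => Finset.sum_congr rfl fun b _ => ?_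
  rw [hrestrict, ← Fintype.prod_subtype_mul_prod_subtype (· ∈ s)]
  simp only [hmem, hnotMem]
  ring

end Products

section Likelihood

variable {X : Type u} {Y : Type v} {W : X → Y → ℝ} {L N : ℕ}

theorem likelihood_nonneg (hW : ∀ x y, 0 ≤ W x y) (k : ℕ) (x : Fin L → Fin N → X)
    (y : Fin L → Fin N → Y) : 0 ≤ likelihood W k x y :=
  Finset.prod_nonneg fun _ _ => Finset.prod_nonneg fun _ _ => hW _ _

theorem likelihood_eq_prod_ite (k : ℕ) (x : Fin L → Fin N → X) (y : Fin L → Fin N → Y) :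
    likelihood W k x y = ∏ r, ∏ i, if r.val < k then W (x r i) (y r i) else 1 := by
  rw [likelihood, Finset.prod_filter]
  refine Finset.prod_congr rfl fun r _ => ?_
  split_ifs with h <;> simp only [Finset.prod_const_one]

theorem likelihood_all (x : Fin L → Fin N → X) (y : Fin L → Fin N → Y) :
    likelihood W L x y = ∏ r, ∏ i, W (x r i) (y r i) := by
  simp [likelihood]

theorem likelihood_pos (hW : ∀ x y, 0 ≤ W x y) {x : Fin L → Fin N → X} {y : Fin L → Fin N → Y}
    (h : 0 < likelihood W L x y) (k : ℕ) : 0 < likelihood W k x y := by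
  rw [likelihood_all] at h
  refine Finset.prod_pos fun r _ => lt_of_le_of_ne' (Finset.prod_nonneg fun i _ => hW _ _) ?_
  exact Finset.prod_ne_zero_iff.1 h.ne' r (Finset.mem_univ r)

theorem likelihood_rpow (hW : ∀ x y, 0 ≤ W x y) (k : ℕ) (x : Fin L → Fin N → X)
    (y : Fin L → Fin N → Y) (u : ℝ) :
    likelihood W k x y ^ u = likelihood (fun x y => W x y ^ u) k x y := by
  rw [likelihood, ← Real.finsetProd_rpow _ _ fun r _ => Finset.prod_nonneg fun i _ => hW _ _]
  exact Finset.prod_congr rfl fun r _ => (Real.finsetProd_rpow _ _ (fun i _ => hW _ _) u).symm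

theorem likelihood_mul_likelihood_rpow (hW : ∀ x y, 0 ≤ W x y) (k : ℕ) {s : ℝ} (hs : s ≠ 1)
    (x : Fin L → Fin N → X) (y : Fin L → Fin N → Y) :
    likelihood W L x y * likelihood W k x y ^ (-s) =
      ∏ r, ∏ i, if r.val < k then W (x r i) (y r i) ^ (1 - s) else W (x r i) (y r i) := by
  rw [likelihood_rpow hW, likelihood_all, likelihood_eq_prod_ite]
  simp only [← Finset.prod_mul_distrib]
  refine Finset.prod_congr rfl fun r _ => Finset.prod_congr rfl fun i _ => ?_
  rw [mul_ite, mul_one, sub_eq_add_neg, Real.rpow_add' (hW _ _), Real.rpow_one]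
  rwa [← sub_eq_add_neg, sub_ne_zero, ne_comm]

theorem dependsOn_likelihood (k : ℕ) (x : Fin L → Fin N → X) :
    DependsOn (likelihood W k x : (Fin L → Fin N → Y) → ℝ) {r | r.val < k} := fun y y' h =>
  Finset.prod_congr rfl fun r hr => by rw [h r (Finset.mem_filter.1 hr).2]

theorem likelihood_le_exp_mul {b : ℝ} (hW : ∀ x y, 0 ≤ W x y)
    (hb : ∀ x x' y, W x y ≤ Real.exp b * W x' y) {k : ℕ} (hk : k ≤ L)
    (x x' : Fin L → Fin N → X) (y : Fin L → Fin N → Y) :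
    likelihood W k x y ≤ Real.exp (k * N * b) * likelihood W k x' y := by
  calc likelihood W k x y
      ≤ ∏ r ∈ Finset.univ.filter (fun r : Fin L => r.val < k),
          ∏ i, Real.exp b * W (x' r i) (y r i) :=
        Finset.prod_le_prod (fun r _ => Finset.prod_nonneg fun i _ => hW _ _) fun r _ =>
          Finset.prod_le_prod (fun i _ => hW _ _) fun i _ => hb _ _ _
    _ = Real.exp (k * N * b) * likelihood W k x' y := by
        simp only [Finset.prod_mul_distrib, Finset.prod_const, Finset.card_univ, Fintype.card_fin,
          Fin.card_filter_val_lt, min_eq_right hk, ← Real.exp_nat_mul, likelihood, mul_assoc]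

variable [Fintype Y]

theorem sum_likelihood (hW : ∀ x, W x ∈ stdSimplex ℝ Y) (x : Fin L → Fin N → X) :
    ∑ y, likelihood W L x y = 1 := by
  simp only [likelihood_all]
  rw [sum_pi_pi_prod fun r i y => W (x r i) y]
  simp only [(hW _).2, Finset.prod_const_one]

theorem sum_likelihood_mul_of_dependsOn (hW : ∀ x, W x ∈ stdSimplex ℝ Y) {k : ℕ}
    {g : (Fin L → Fin N → Y) → ℝ} (hg : DependsOn g {r | r.val < k}) (x : Fin L → Fin N → X) :
    ∑ y, likelihood W k x y * g y =
      (Fintype.card (Fin N → Y) : ℝ) ^ (L - k) * ∑ y, likelihood W L x y * g y := by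
  obtain ⟨g, rfl⟩ := dependsOn_iff_exists_comp.1 hg
  have hcard : Fintype.card {r : Fin L // r ∉ {r : Fin L | r.val < k}} = L - k := by
    have := Fin.card_filter_val_lt (n := L) (m := k)
    have := Fintype.card_subtype_compl fun r : Fin L => r.val < k
    simp only [Fintype.card_subtype, Fintype.card_fin] at this
    simp only [Set.mem_ofPred_eq, Fintype.card_subtype]
    omega
  have hk := sum_prod_mul_restrict {r : Fin L | r.val < k}
    (fun r b => if r.val < k then ∏ i : Fin N, W (x r i) (b i) else 1) g
  have hL := sum_prod_mul_restrict {r : Fin L | r.val < k}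
    (fun r b => ∏ i : Fin N, W (x r i) (b i)) g
  have hlate : ∏ r : {r : Fin L // r ∉ {r : Fin L | r.val < k}},
      ∑ b : Fin N → Y, (if r.1.val < k then ∏ i, W (x r i) (b i) else 1) =
        (Fintype.card (Fin N → Y) : ℝ) ^ (L - k) := by
    rw [← hcard, ← Finset.card_univ (α := {r : Fin L // _}), ← Finset.prod_const]
    exact Finset.prod_congr rfl fun r _ =>
      (Finset.sum_congr rfl fun b _ => if_neg r.2).trans (by simp)
  have hlate_one : ∏ r : {r : Fin L // r ∉ {r : Fin L | r.val < k}},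
      ∑ b : Fin N → Y, ∏ i, W (x r i) (b i) = 1 := by
    simp only [← Fintype.prod_sum, (hW _).2, Finset.prod_const_one]
  have hearly : ∀ (r : {r : Fin L | r.val < k}) (b : Fin N → Y),
      (if r.1.val < k then ∏ i, W (x r i) (b i) else 1) = ∏ i, W (x r i) (b i) :=
    fun r b => if_pos r.2
  simp only [hlate_one, one_mul] at hL
  simp only [hlate, hearly, ← hL] at hk
  simp only [likelihood_all]
  simpa only [likelihood, Finset.prod_filter, Function.comp_apply] using hk

end Likelihood

section Decoders

variable {X : Type u} {Y : Type v} {W : X → Y → ℝ} {M L N : ℕ} {k : ℕ} {t : ℝ}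
  {c : Fin M → Fin L → Fin N → X} {y : Fin L → Fin N → Y} {m : Fin M}

theorem dependsOn_erasureDecode (k : ℕ) (t : ℝ) (c : Fin M → Fin L → Fin N → X) :
    DependsOn (erasureDecode (Y := Y) W k t c) {r | r.val < k} := fun y y' h => by
  have hregion : InRegion W k t c y = InRegion W k t c y' := funext fun m => by
    simp only [InRegion, dependsOn_likelihood k _ h]
  unfold erasureDecode
  rw [hregion]

theorem inRegion_of_erasureDecode_eq_some (h : erasureDecode W k t c y = some m) :
    InRegion W k t c y m := by
  unfold erasureDecode at h
  split_ifs at h with hex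
  exact Option.some.inj h ▸ hex.choose_spec

theorem erasureDecode_eq_none_iff :
    erasureDecode W k t c y = none ↔ ∀ m, ¬ InRegion W k t c y m := by
  simp [erasureDecode]

theorem likelihood_le_sum_of_mlDecode_ne (hW : ∀ x y, 0 ≤ W x y) (h : mlDecode W c y ≠ some m) :
    likelihood W L (c m) y ≤ ∑ i ∈ Finset.univ.erase m, likelihood W L (c i) y := by
  have hex : ∃ m', ∀ i, likelihood W L (c i) y ≤ likelihood W L (c m') y := by
    have : Nonempty (Fin M) := ⟨m⟩
    exact Finite.exists_max fun i => likelihood W L (c i) y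
  have hne : hex.choose ≠ m := fun hm => h (by rw [mlDecode, dif_pos hex, hm])
  exact (hex.choose_spec m).trans <| Finset.single_le_sum
    (f := fun i => likelihood W L (c i) y) (fun i _ => likelihood_nonneg hW _ _ _)
    (Finset.mem_erase.2 ⟨hne, Finset.mem_univ _⟩)

theorem erasureDecode_eq_none_of_lt {b : ℝ} (hW : ∀ x y, 0 ≤ W x y)
    (hb : ∀ x x' y, W x y ≤ Real.exp b * W x' y) (hbt : b < t) (hM : 2 ≤ M) (hN : 1 ≤ N)
    (hk : 1 ≤ k) (hkL : k ≤ L) (hpos : 0 < likelihood W L (c m) y) :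
    erasureDecode W k t c y = none := by
  refine erasureDecode_eq_none_iff.2 fun m' hm' => ?_
  have : Nontrivial (Fin M) := Fin.nontrivial_iff_two_le.2 hM
  obtain ⟨j, hj⟩ := exists_ne m'
  have hratio := likelihood_le_exp_mul (N := N) hW hb hkL
  have hj_pos : 0 < likelihood W k (c j) y :=
    pos_of_mul_pos_right ((likelihood_pos hW hpos k).trans_le (hratio (c m) (c j) y))
      (Real.exp_pos _).le
  have hle : Real.exp (k * N * t) * likelihood W k (c j) y ≤
      Real.exp (k * N * b) * likelihood W k (c j) y :=
    calc _ ≤ Real.exp (k * N * t) * ∑ i ∈ Finset.univ.erase m', likelihood W k (c i) y :=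
          mul_le_mul_of_nonneg_left (Finset.single_le_sum (f := fun i => likelihood W k (c i) y)
            (fun i _ => likelihood_nonneg hW _ _ _) (Finset.mem_erase.2 ⟨hj, Finset.mem_univ j⟩))
            (Real.exp_pos _).le
      _ ≤ likelihood W k (c m') y := hm'
      _ ≤ _ := hratio _ _ _
  have hkN : (0 : ℝ) < k * N := by positivity
  exact absurd (Real.exp_le_exp.1 (le_of_mul_le_mul_right hle hj_pos))
    (not_le.2 (mul_lt_mul_of_pos_left hbt hkN))

variable {T : ℕ → ℝ}

theorem rounds_mem (W : X → Y → ℝ) (T : ℕ → ℝ) (c : Fin M → Fin L → Fin N → X)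
    (y : Fin L → Fin N → Y) :
    (1 ≤ rounds W T c y ∧ rounds W T c y < L ∧
      erasureDecode W (rounds W T c y) (T (rounds W T c y)) c y ≠ none) ∨ rounds W T c y = L :=
  Nat.sInf_mem (s := {k | (1 ≤ k ∧ k < L ∧ erasureDecode W k (T k) c y ≠ none) ∨ k = L})
    ⟨L, Or.inr rfl⟩

theorem one_le_rounds (hL : 1 ≤ L) : 1 ≤ rounds W T c y :=
  (rounds_mem W T c y).elim (fun h => h.1) fun h => hL.trans h.ge

theorem rounds_le : rounds W T c y ≤ L :=
  Nat.sInf_le (Or.inr rfl)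

theorem rounds_le_one (hL : 1 ≤ L) (h : erasureDecode W 1 (T 1) c y ≠ none) :
    rounds W T c y ≤ 1 :=
  hL.eq_or_lt.elim (fun hL => rounds_le.trans hL.ge) fun hL =>
    Nat.sInf_le (Or.inl ⟨le_rfl, hL, h⟩)

theorem rounds_eq_of_forall_eq_none
    (h : ∀ k, 1 ≤ k → k < L → erasureDecode W k (T k) c y = none) : rounds W T c y = L :=
  (rounds_mem W T c y).resolve_left fun ⟨h1, h2, hne⟩ => hne (h _ h1 h2)

theorem exists_undetected_or_le_of_decision_ne (hW : ∀ x y, 0 ≤ W x y)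
    (h : decision W T c y ≠ some m) :
    (∃ k ∈ Finset.Ico 1 L, ∃ m', m' ≠ m ∧ erasureDecode W k (T k) c y = some m') ∨
      likelihood W L (c m) y ≤ ∑ i ∈ Finset.univ.erase m, likelihood W L (c i) y := by
  rcases rounds_mem W T c y with ⟨h1, hL, hne⟩ | hL
  · rw [decision, if_pos hL] at h
    obtain ⟨m', hm'⟩ := Option.ne_none_iff_exists'.1 hne
    exact Or.inl ⟨_, Finset.mem_Ico.2 ⟨h1, hL⟩, m', fun hm => h (hm ▸ hm'), hm'⟩
  · rw [decision, if_neg hL.not_lt] at h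
    exact Or.inr (likelihood_le_sum_of_mlDecode_ne hW h)

end Decoders

section Mean

variable {X : Type u} {Y : Type v} [Fintype X] [Fintype Y] {W : X → Y → ℝ} {p : X → ℝ}
  {M L N : ℕ} {f g : (Fin M → Fin L → Fin N → X) → Fin M → (Fin L → Fin N → Y) → ℝ}

theorem mean_mono (hW : ∀ x y, 0 ≤ W x y) (hp : ∀ x, 0 ≤ p x)
    (h : ∀ c m y, 0 < likelihood W L (c m) y → f c m y ≤ g c m y) :
    mean W p f ≤ mean W p g := by
  refine Finset.sum_le_sum fun c _ => mul_le_mul_of_nonneg_left ?_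
    (Finset.prod_nonneg fun _ _ => Finset.prod_nonneg fun _ _ => Finset.prod_nonneg fun _ _ => hp _)
  refine mul_le_mul_of_nonneg_left (Finset.sum_le_sum fun m _ => Finset.sum_le_sum fun y _ => ?_)
    (by positivity)
  rcases (likelihood_nonneg hW L (c m) y).eq_or_lt' with hzero | hpos
  · simp only [hzero, zero_mul, le_refl]
  · exact mul_le_mul_of_nonneg_left (h c m y hpos) hpos.le

theorem mean_const (hW : ∀ x, W x ∈ stdSimplex ℝ Y) (hp : p ∈ stdSimplex ℝ X) (hM : 0 < M)
    (a : ℝ) : mean W p (fun (_ : Fin M → Fin L → Fin N → X) _ _ => a) = a := by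
  have hM' : (M : ℝ) ≠ 0 := Nat.cast_ne_zero.2 hM.ne'
  have hcode := (prod_mem_stdSimplex (ι := Fin M)
    (prod_mem_stdSimplex (ι := Fin L) (prod_mem_stdSimplex (ι := Fin N) hp))).2
  simp only [mean, ← Finset.sum_mul, sum_likelihood hW, hcode, Finset.sum_const, Finset.card_univ,
    Fintype.card_fin, nsmul_eq_mul]
  field_simp

theorem mean_add : mean W p (fun c m y => f c m y + g c m y) = mean W p f + mean W p g := by
  simp only [mean, mul_add, Finset.sum_add_distrib]

theorem mean_const_mul (a : ℝ) : mean W p (fun c m y => a * f c m y) = a * mean W p f := by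
  simp only [mean, Finset.mul_sum]
  refine Finset.sum_congr rfl fun c _ => Finset.sum_congr rfl fun m _ =>
    Finset.sum_congr rfl fun y _ => by ring

theorem mean_le_of_forall_message (hM : 0 < M) {B : ℝ}
    (h : ∀ m, ∑ c : Fin M → Fin L → Fin N → X, (∏ m, ∏ r, ∏ i, p (c m r i)) *
      ∑ y : Fin L → Fin N → Y, likelihood W L (c m) y * f c m y ≤ B) :
    mean W p f ≤ B := by
  have hM' : (M : ℝ) ≠ 0 := Nat.cast_ne_zero.2 hM.ne'
  calc mean W p f
      = 1 / (M : ℝ) * ∑ m, ∑ c : Fin M → Fin L → Fin N → X, (∏ m, ∏ r, ∏ i, p (c m r i)) *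
          ∑ y : Fin L → Fin N → Y, likelihood W L (c m) y * f c m y := by
        simp only [mean, Finset.mul_sum]
        rw [Finset.sum_comm]
        refine Finset.sum_congr rfl fun c _ => Finset.sum_congr rfl fun m _ =>
          Finset.sum_congr rfl fun y _ => by ring
    _ ≤ 1 / (M : ℝ) * ∑ _m : Fin M, B :=
        mul_le_mul_of_nonneg_left (Finset.sum_le_sum fun m _ => h m) (by positivity)
    _ = B := by
        simp only [Finset.sum_const, Finset.card_univ, Fintype.card_fin, nsmul_eq_mul]
        field_simp

open Classical in
/-- The probability of an event that depends on the codebook, the message and the outputs, under the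
law with expectation `mean`. -/
def prob {X : Type u} {Y : Type v} [Fintype X] [Fintype Y] (W : X → Y → ℝ) (p : X → ℝ)
    {M L N : ℕ} (E : (Fin M → Fin L → Fin N → X) → Fin M → (Fin L → Fin N → Y) → Prop) : ℝ :=
  mean W p fun c m y => if E c m y then 1 else 0

variable {E F : (Fin M → Fin L → Fin N → X) → Fin M → (Fin L → Fin N → Y) → Prop}

theorem prob_mono (hW : ∀ x y, 0 ≤ W x y) (hp : ∀ x, 0 ≤ p x)
    (h : ∀ c m y, E c m y → F c m y) : prob W p E ≤ prob W p F :=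
  mean_mono hW hp fun c m y _ => by
    by_cases hE : E c m y
    · rw [if_pos hE, if_pos (h c m y hE)]
    · rw [if_neg hE]
      split_ifs <;> norm_num

theorem prob_or_le (hW : ∀ x y, 0 ≤ W x y) (hp : ∀ x, 0 ≤ p x) :
    prob W p (fun c m y => E c m y ∨ F c m y) ≤ prob W p E + prob W p F := by
  rw [prob, prob, prob, ← mean_add]
  refine mean_mono hW hp fun c m y _ => ?_
  by_cases hE : E c m y <;> by_cases hF : F c m y <;> simp [hE, hF]

theorem prob_exists_mem_le (hW : ∀ x y, 0 ≤ W x y) (hp : ∀ x, 0 ≤ p x) (s : Finset ℕ)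
    (E : ℕ → (Fin M → Fin L → Fin N → X) → Fin M → (Fin L → Fin N → Y) → Prop) :
    prob W p (fun c m y => ∃ k ∈ s, E k c m y) ≤ ∑ k ∈ s, prob W p (E k) := by
  induction s using Finset.induction_on with
  | empty => simp [prob, mean]
  | insert k s hk ih =>
    rw [Finset.sum_insert hk]
    simp only [Finset.exists_mem_insert]
    exact (prob_or_le hW hp).trans (by gcongr)

theorem prError_eq_prob (T : ℕ → ℝ) :
    prError W p L N M T =
      prob W p (M := M) (L := L) (N := N) fun c m y => decision W T c y ≠ some m := by
  refine congrArg (mean W p) (funext₃ fun c m y => ?_)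
  by_cases h : decision W T c y = some m <;> simp [h]

end Mean

section RandomCodingBound

variable {X : Type u} {Y : Type v} [Fintype X] [Fintype Y] {W : X → Y → ℝ} {p : X → ℝ}
  {M L N : ℕ}

theorem rpow_sum_le_sum_rpow {ι : Type*} (t : Finset ι) {f : ι → ℝ} (hf : ∀ i, 0 ≤ f i) {u : ℝ}
    (hu : 0 < u) (hu1 : u ≤ 1) : (∑ i ∈ t, f i) ^ u ≤ ∑ i ∈ t, f i ^ u :=
  Finset.le_sum_of_subadditive_on_pred (· ^ u) (0 ≤ ·) (Real.zero_rpow hu.ne').le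
    (fun _ _ hx hy => Real.rpow_add_le_add_rpow hx hy hu.le hu1) (fun _ _ => add_nonneg) _
    fun i _ => hf i

theorem one_le_mul_rpow_mul_sum_rpow {ι : Type*} (t : Finset ι) {f : ι → ℝ} (hf : ∀ i, 0 ≤ f i)
    {K l s ρ : ℝ} (hl : 0 < l) (hK : 0 ≤ K) (h : l ≤ K * ∑ i ∈ t, f i) (hs : 0 < s) (hsρ : s ≤ ρ) :
    1 ≤ K ^ s * (l ^ (-s) * (∑ i ∈ t, f i ^ (s / ρ)) ^ ρ) := by
  have hρ : 0 < ρ := hs.trans_le hsρ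
  have hsum : 0 ≤ ∑ i ∈ t, f i := Finset.sum_nonneg fun i _ => hf i
  calc (1 : ℝ) = l ^ (-s) * l ^ s := by
        rw [← Real.rpow_add hl, neg_add_cancel, Real.rpow_zero]
    _ ≤ l ^ (-s) * (K * ∑ i ∈ t, f i) ^ s := by gcongr
    _ = K ^ s * (l ^ (-s) * ((∑ i ∈ t, f i) ^ (s / ρ)) ^ ρ) := by
        rw [Real.mul_rpow hK hsum, ← Real.rpow_mul hsum, div_mul_cancel₀ s hρ.ne']
        ring
    _ ≤ K ^ s * (l ^ (-s) * (∑ i ∈ t, f i ^ (s / ρ)) ^ ρ) := by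
        gcongr
        exact rpow_sum_le_sum_rpow t hf (div_pos hs hρ) ((div_le_one hρ).2 hsρ)

theorem sum_sum_likelihood_mul_rpow (hW : ∀ x, W x ∈ stdSimplex ℝ Y) (hp : p ∈ stdSimplex ℝ X)
    {k : ℕ} (hk : k ≤ L) {s : ℝ} (hs : s ≠ 1) (u ρ : ℝ) :
    ∑ y : Fin L → Fin N → Y,
        (∑ x, (∏ r, ∏ i, p (x r i)) * (likelihood W L x y * likelihood W k x y ^ (-s))) *
          (∑ x, (∏ r, ∏ i, p (x r i)) * likelihood W k x y ^ u) ^ ρ =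
      (∑ y, (∑ x, p x * W x y ^ (1 - s)) * (∑ x, p x * W x y ^ u) ^ ρ) ^ (k * N) := by
  have hW0 : ∀ x y, 0 ≤ W x y := fun x => (hW x).1
  simp only [likelihood_mul_likelihood_rpow hW0 k hs]
  simp only [likelihood_rpow hW0]
  simp only [likelihood_eq_prod_ite, ← Finset.prod_mul_distrib]
  rw [sum_pi_pi_prod_mul_rpow
    (F := fun (r : Fin L) a b => p a * if r.val < k then W a b ^ (1 - s) else W a b)
    (H := fun (r : Fin L) a b => p a * if r.val < k then W a b ^ u else 1)]
  · have hround : ∀ r : Fin L,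
        (∑ b, (∑ a, p a * if r.val < k then W a b ^ (1 - s) else W a b) *
          (∑ a, p a * if r.val < k then W a b ^ u else 1) ^ ρ) =
        if r.val < k then ∑ b, (∑ a, p a * W a b ^ (1 - s)) * (∑ a, p a * W a b ^ u) ^ ρ
        else 1 := by
      intro r
      split_ifs
      · rfl
      · simp only [mul_one, hp.2, Real.one_rpow]
        rw [Finset.sum_comm]
        simp only [← Finset.mul_sum, (hW _).2, mul_one, hp.2]
    simp only [hround, Fintype.card_fin, ite_pow, one_pow]
    rw [Finset.prod_ite, Finset.prod_const, Finset.prod_const_one, mul_one,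
      Fin.card_filter_val_lt, min_eq_right hk, ← pow_mul, mul_comm]
  · intro r a b
    have := Real.rpow_nonneg (hW0 a b) u
    have := hp.1 a
    positivity

theorem sum_pow_le_exp_neg_Eo (hW : ∀ x y, 0 ≤ W x y) (hp : ∀ x, 0 ≤ p x) (s ρ : ℝ) (n : ℕ) :
    (∑ y, (∑ x, p x * W x y ^ (1 - s)) * (∑ x, p x * W x y ^ (s / ρ)) ^ ρ) ^ n ≤
      Real.exp (-(n * Eo W s ρ p)) := by
  have hsum : ∀ (u : ℝ) y, 0 ≤ ∑ x, p x * W x y ^ u := fun u y =>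
    Finset.sum_nonneg fun x _ => mul_nonneg (hp x) (Real.rpow_nonneg (hW x y) u)
  rw [Eo, mul_neg, neg_neg, Real.exp_nat_mul]
  exact pow_le_pow_left₀ (Finset.sum_nonneg fun y _ =>
    mul_nonneg (hsum _ y) (Real.rpow_nonneg (hsum _ y) ρ)) (Real.le_exp_log _) n

theorem mean_rpow_mul_sum_rpow_le (hW : ∀ x, W x ∈ stdSimplex ℝ Y) (hp : p ∈ stdSimplex ℝ X)
    (hM : 0 < M) {k : ℕ} (hk : k ≤ L) {s ρ : ℝ} (hs : s ≠ 1) (hρ : 0 ≤ ρ) (hρ1 : ρ ≤ 1) :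
    mean W p (fun (c : Fin M → Fin L → Fin N → X) m y => likelihood W k (c m) y ^ (-s) *
        (∑ i ∈ Finset.univ.erase m, likelihood W k (c i) y ^ (s / ρ)) ^ ρ) ≤
      (M : ℝ) ^ ρ * Real.exp (-(k * N * Eo W s ρ p)) := by
  have hW0 : ∀ x y, 0 ≤ W x y := fun x => (hW x).1
  have hrpow : ∀ (x : Fin L → Fin N → X) (y : Fin L → Fin N → Y) (u : ℝ),
      0 ≤ likelihood W k x y ^ u := fun x y u => Real.rpow_nonneg (likelihood_nonneg hW0 k x y) u
  have hcode := prod_mem_stdSimplex (ι := Fin L) (prod_mem_stdSimplex (ι := Fin N) hp)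
  refine mean_le_of_forall_message hM fun m => ?_
  calc _ = ∑ y : Fin L → Fin N → Y, ∑ c : Fin M → Fin L → Fin N → X,
          (∏ m, ∏ r, ∏ i, p (c m r i)) *
            ((likelihood W L (c m) y * likelihood W k (c m) y ^ (-s)) *
              (∑ i ∈ Finset.univ.erase m, likelihood W k (c i) y ^ (s / ρ)) ^ ρ) := by
        simp only [Finset.mul_sum, ← mul_assoc]
        exact Finset.sum_comm
    _ ≤ ∑ y : Fin L → Fin N → Y,
          (∑ x, (∏ r, ∏ i, p (x r i)) * (likelihood W L x y * likelihood W k x y ^ (-s))) *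
            (M * ∑ x, (∏ r, ∏ i, p (x r i)) * likelihood W k x y ^ (s / ρ)) ^ ρ := by
        refine Finset.sum_le_sum fun y _ => ?_
        simpa only [Fintype.card_fin] using sum_prod_mul_mul_sum_erase_rpow_le hcode
          (fun x => mul_nonneg (likelihood_nonneg hW0 L x y) (hrpow x y _))
          (fun x => hrpow x y (s / ρ)) hρ hρ1 m
    _ = (M : ℝ) ^ ρ *
          (∑ y, (∑ x, p x * W x y ^ (1 - s)) * (∑ x, p x * W x y ^ (s / ρ)) ^ ρ) ^ (k * N) := by
        rw [← sum_sum_likelihood_mul_rpow hW hp hk hs, Finset.mul_sum]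
        refine Finset.sum_congr rfl fun y _ => ?_
        rw [Real.mul_rpow M.cast_nonneg (Finset.sum_nonneg fun x _ =>
          mul_nonneg (hcode.1 x) (hrpow x y _))]
        ring
    _ ≤ (M : ℝ) ^ ρ * Real.exp (-(k * N * Eo W s ρ p)) := by
        rw [← Nat.cast_mul]
        gcongr
        exact sum_pow_le_exp_neg_Eo hW0 hp.1 s ρ (k * N)

theorem prob_likelihood_le_mul_sum_le (hW : ∀ x, W x ∈ stdSimplex ℝ Y) (hp : p ∈ stdSimplex ℝ X)
    (hM : 0 < M) {k : ℕ} (hk : k ≤ L) {s ρ : ℝ} (hs : 0 < s) (hs1 : s < 1) (hsρ : s ≤ ρ)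
    (hρ : ρ ≤ 1) (t : ℝ) :
    prob W p (fun (c : Fin M → Fin L → Fin N → X) m y => likelihood W k (c m) y ≤
        Real.exp (k * N * t) * ∑ i ∈ Finset.univ.erase m, likelihood W k (c i) y) ≤
      (M : ℝ) ^ ρ * Real.exp (-(k * N * (Eo W s ρ p - s * t))) := by
  have hW0 : ∀ x y, 0 ≤ W x y := fun x => (hW x).1
  calc _ ≤ mean W p (fun (c : Fin M → Fin L → Fin N → X) m y => Real.exp (k * N * t) ^ s *
          (likelihood W k (c m) y ^ (-s) *
            (∑ i ∈ Finset.univ.erase m, likelihood W k (c i) y ^ (s / ρ)) ^ ρ)) := by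
        refine mean_mono hW0 hp.1 fun c m y hpos => ?_
        have hl := likelihood_pos hW0 hpos k
        split_ifs with hle
        · exact one_le_mul_rpow_mul_sum_rpow _ (fun i => likelihood_nonneg hW0 k (c i) y) hl
            (Real.exp_pos _).le hle hs hsρ
        · have := Finset.sum_nonneg fun i (_ : i ∈ Finset.univ.erase m) =>
            Real.rpow_nonneg (likelihood_nonneg hW0 k (c i) y) (s / ρ)
          positivity
    _ ≤ Real.exp (k * N * t) ^ s * ((M : ℝ) ^ ρ * Real.exp (-(k * N * Eo W s ρ p))) := by
        rw [mean_const_mul]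
        gcongr
        exact mean_rpow_mul_sum_rpow_le hW hp hM hk hs1.ne (hs.le.trans hsρ) hρ
    _ = (M : ℝ) ^ ρ * Real.exp (-(k * N * (Eo W s ρ p - s * t))) := by
        rw [← Real.exp_mul, mul_left_comm, ← Real.exp_add]
        ring_nf

end RandomCodingBound

section ErrorAndDelay

variable {X : Type u} {Y : Type v} {W : X → Y → ℝ} {p : X → ℝ} {M L N : ℕ} {T : ℕ → ℝ}

open Classical in
theorem sum_likelihood_undetected_le (hW : ∀ x y, 0 ≤ W x y) (k : ℕ) (t : ℝ)
    (c : Fin M → Fin L → Fin N → X) (y : Fin L → Fin N → Y) :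
    ∑ m, likelihood W k (c m) y *
        (if ∃ m', m' ≠ m ∧ erasureDecode W k t c y = some m' then 1 else 0) ≤
      Real.exp (-(k * N * t)) * ∑ m, likelihood W k (c m) y := by
  have hl := fun m => likelihood_nonneg hW k (c m) y
  cases hdec : erasureDecode W k t c y with
  | none =>
    simpa using mul_nonneg (Real.exp_pos (-(k * N * t))).le (Finset.sum_nonneg fun m _ => hl m)
  | some m₀ =>
    have hregion : Real.exp (k * N * t) * ∑ i ∈ Finset.univ.erase m₀, likelihood W k (c i) y ≤
        likelihood W k (c m₀) y := inRegion_of_erasureDecode_eq_some hdec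
    have hset : Finset.univ.filter (fun m => ∃ m', m' ≠ m ∧ some m₀ = some m') =
        Finset.univ.erase m₀ := by
      ext m
      simp [eq_comm]
    simp only [mul_ite, mul_one, mul_zero]
    rw [← Finset.sum_filter, hset, Real.exp_neg, ← div_eq_inv_mul, le_div_iff₀' (Real.exp_pos _)]
    exact hregion.trans (Finset.single_le_sum (f := fun m => likelihood W k (c m) y)
      (fun m _ => hl m) (Finset.mem_univ m₀))

open Classical in
theorem sum_sum_likelihood_undetected_le [Fintype Y] [Nonempty Y]
    (hW : ∀ x, W x ∈ stdSimplex ℝ Y) (k : ℕ) (t : ℝ) (c : Fin M → Fin L → Fin N → X) :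
    ∑ m, ∑ y, likelihood W L (c m) y *
        (if ∃ m', m' ≠ m ∧ erasureDecode W k t c y = some m' then 1 else 0) ≤
      Real.exp (-(k * N * t)) * M := by
  have hK : (0 : ℝ) < (Fintype.card (Fin N → Y) : ℝ) ^ (L - k) :=
    pow_pos (Nat.cast_pos.2 Fintype.card_pos) _
  have hdep : ∀ m, DependsOn (fun y : Fin L → Fin N → Y =>
      if ∃ m', m' ≠ m ∧ erasureDecode W k t c y = some m' then (1 : ℝ) else 0)
      {r | r.val < k} := fun m y y' h => by
    simp only [dependsOn_erasureDecode k t c h]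
  refine le_of_mul_le_mul_left ?_ hK
  calc _ = ∑ y, ∑ m, likelihood W k (c m) y *
          (if ∃ m', m' ≠ m ∧ erasureDecode W k t c y = some m' then 1 else 0) := by
        rw [Finset.mul_sum, Finset.sum_comm]
        exact Finset.sum_congr rfl fun m _ => (sum_likelihood_mul_of_dependsOn hW (hdep m) _).symm
    _ ≤ ∑ y, Real.exp (-(k * N * t)) * ∑ m, likelihood W k (c m) y :=
        Finset.sum_le_sum fun y _ => sum_likelihood_undetected_le (fun x => (hW x).1) k t c y
    _ = _ := by
        have hsum : ∀ m, ∑ y, likelihood W k (c m) y = (Fintype.card (Fin N → Y) : ℝ) ^ (L - k) :=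
          fun m => by
            simpa only [mul_one, sum_likelihood hW] using
              sum_likelihood_mul_of_dependsOn (g := fun _ => 1) hW (fun _ _ _ => rfl) (c m)
        rw [← Finset.mul_sum, Finset.sum_comm]
        simp only [hsum, Finset.sum_const, Finset.card_univ, Fintype.card_fin, nsmul_eq_mul]
        ring

theorem nonempty_of_mem_stdSimplex {A : Type*} [Fintype A] {q : A → ℝ} (hq : q ∈ stdSimplex ℝ A) :
    Nonempty A :=
  Finset.univ_nonempty_iff.1 <| Finset.nonempty_of_sum_ne_zero (hq.2.trans_ne one_ne_zero)

variable [Fintype X] [Fintype Y]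

theorem prob_undetected_le (hW : ∀ x, W x ∈ stdSimplex ℝ Y) (hp : p ∈ stdSimplex ℝ X)
    (k : ℕ) (t : ℝ) :
    prob W p (fun (c : Fin M → Fin L → Fin N → X) m y =>
        ∃ m', m' ≠ m ∧ erasureDecode W k t c y = some m') ≤ Real.exp (-(k * N * t)) := by
  obtain ⟨x⟩ := nonempty_of_mem_stdSimplex hp
  have : Nonempty Y := nonempty_of_mem_stdSimplex (hW x)
  have hcode := prod_mem_stdSimplex (ι := Fin M)
    (prod_mem_stdSimplex (ι := Fin L) (prod_mem_stdSimplex (ι := Fin N) hp))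
  calc _ ≤ ∑ c : Fin M → Fin L → Fin N → X, (∏ m, ∏ r, ∏ i, p (c m r i)) *
          Real.exp (-(k * N * t)) := by
        refine Finset.sum_le_sum fun c _ => mul_le_mul_of_nonneg_left ?_ (hcode.1 c)
        rw [one_div, inv_mul_eq_div]
        refine div_le_of_le_mul₀ M.cast_nonneg (Real.exp_pos _).le ?_
        exact (by congr! : _ = _).trans_le (sum_sum_likelihood_undetected_le hW k t c)
    _ = Real.exp (-(k * N * t)) := by rw [← Finset.sum_mul, hcode.2, one_mul]

theorem prError_le (hW : ∀ x, W x ∈ stdSimplex ℝ Y) (hp : p ∈ stdSimplex ℝ X) (hM : 0 < M)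
    {s ρ : ℝ} (hs : 0 < s) (hs1 : s < 1) (hsρ : s ≤ ρ) (hρ : ρ ≤ 1) :
    prError W p L N M T ≤ ∑ k ∈ Finset.Ico 1 L, Real.exp (-(k * N * T k)) +
      (M : ℝ) ^ ρ * Real.exp (-(L * N * Eo W s ρ p)) := by
  have hW0 : ∀ x y, 0 ≤ W x y := fun x => (hW x).1
  have hml := prob_likelihood_le_mul_sum_le (L := L) (N := N) hW hp hM le_rfl hs hs1 hsρ hρ 0
  simp only [mul_zero, Real.exp_zero, one_mul, sub_zero] at hml
  rw [prError_eq_prob]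
  calc _ ≤ _ := prob_mono hW0 hp.1 fun c m y => exists_undetected_or_le_of_decision_ne hW0
    _ ≤ _ := prob_or_le hW0 hp.1
    _ ≤ _ := add_le_add ((prob_exists_mem_le hW0 hp.1 _ _).trans
        (Finset.sum_le_sum fun k _ => prob_undetected_le hW hp k (T k))) hml

theorem prError_le_one (hW : ∀ x, W x ∈ stdSimplex ℝ Y) (hp : p ∈ stdSimplex ℝ X) (hM : 0 < M) :
    prError W p L N M T ≤ 1 := by
  rw [← mean_const hW hp hM (L := L) (N := N) 1]
  refine mean_mono (fun x => (hW x).1) hp.1 fun c m y _ => ?_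
  split_ifs <;> norm_num

theorem le_avgDelay (hW : ∀ x, W x ∈ stdSimplex ℝ Y) (hp : p ∈ stdSimplex ℝ X) (hM : 0 < M)
    (hL : 1 ≤ L) : (N : ℝ) ≤ avgDelay W p L N M T := by
  rw [← mean_const hW hp hM (L := L) (N := N) (N : ℝ)]
  exact mean_mono (fun x => (hW x).1) hp.1 fun c m y _ =>
    le_mul_of_one_le_right N.cast_nonneg (Nat.one_le_cast.2 (one_le_rounds hL))

theorem avgDelay_le (hW : ∀ x, W x ∈ stdSimplex ℝ Y) (hp : p ∈ stdSimplex ℝ X) (hM : 0 < M)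
    (hL : 1 ≤ L) {s ρ : ℝ} (hs : 0 < s) (hs1 : s < 1) (hsρ : s ≤ ρ) (hρ : ρ ≤ 1) :
    avgDelay W p L N M T ≤
      N + N * L * ((M : ℝ) ^ ρ * Real.exp (-(N * (Eo W s ρ p - s * T 1)))) := by
  have hW0 : ∀ x y, 0 ≤ W x y := fun x => (hW x).1
  have hprob := prob_likelihood_le_mul_sum_le (N := N) hW hp hM hL hs hs1 hsρ hρ (T 1)
  simp only [Nat.cast_one, one_mul] at hprob
  refine le_trans ?_ (add_le_add_right (mul_le_mul_of_nonneg_left hprob (by positivity)) _)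
  rw [prob, ← mean_const_mul]
  nth_rw 1 [← mean_const hW hp hM (L := L) (N := N) (N : ℝ)]
  rw [← mean_add]
  refine mean_mono hW0 hp.1 fun c m y _ => ?_
  split_ifs with hle
  · have : (rounds W T c y : ℝ) ≤ L := Nat.cast_le.2 rounds_le
    nlinarith [N.cast_nonneg (α := ℝ)]
  · have hdec : erasureDecode W 1 (T 1) c y ≠ none := fun h =>
      erasureDecode_eq_none_iff.1 h m (by simpa [InRegion] using (not_le.1 hle).le)
    have : (rounds W T c y : ℝ) ≤ 1 := mod_cast rounds_le_one hL hdec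
    nlinarith [N.cast_nonneg (α := ℝ)]

theorem avgDelay_eq_of_forall_lt {b : ℝ} (hW : ∀ x, W x ∈ stdSimplex ℝ Y)
    (hp : p ∈ stdSimplex ℝ X) (hb : ∀ x x' y, W x y ≤ Real.exp b * W x' y) (hT : ∀ k, b < T k)
    (hM : 2 ≤ M) (hN : 1 ≤ N) : avgDelay W p L N M T = N * L := by
  have hW0 : ∀ x y, 0 ≤ W x y := fun x => (hW x).1
  have hrounds : ∀ (c : Fin M → Fin L → Fin N → X) m y, 0 < likelihood W L (c m) y →
      rounds W T c y = L := fun c m y hpos => rounds_eq_of_forall_eq_none fun k h1 hkL =>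
    erasureDecode_eq_none_of_lt hW0 hb (hT k) hM hN h1 hkL.le hpos
  rw [← mean_const hW hp (zero_lt_two.trans_le hM) (L := L) (N := N) ((N : ℝ) * L)]
  exact le_antisymm (mean_mono hW0 hp.1 fun c m y hpos => by rw [hrounds c m y hpos])
    (mean_mono hW0 hp.1 fun c m y hpos => by rw [hrounds c m y hpos])

end ErrorAndDelay

/-! ### The exponent of IR-ARQ -/

section Messages

/-- The number of messages used at rate `R` per symbol of a round of `N` symbols. The summand `N`
makes it tend to infinity also for `R = 0`. -/
def messages (R : ℝ) (N : ℕ) : ℕ := ⌈Real.exp (N * R)⌉₊ + N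

variable {R : ℝ}

theorem le_messages (R : ℝ) (N : ℕ) : N ≤ messages R N := Nat.le_add_left N _

theorem tendsto_messages (R : ℝ) : Tendsto (messages R) atTop atTop :=
  tendsto_atTop_mono (le_messages R) tendsto_id

theorem exp_le_messages (R : ℝ) (N : ℕ) : Real.exp (N * R) ≤ messages R N := by
  rw [messages, Nat.cast_add]
  exact (Nat.le_ceil _).trans (le_add_of_nonneg_right N.cast_nonneg)

theorem messages_le (hR : 0 ≤ R) (N : ℕ) : (messages R N : ℝ) ≤ (N + 2) * Real.exp (N * R) := by
  have hceil := Nat.ceil_lt_add_one (Real.exp_pos (N * R)).le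
  have hone : 1 ≤ Real.exp (N * R) := Real.one_le_exp (by positivity)
  rw [messages, Nat.cast_add]
  nlinarith [(Nat.cast_nonneg N : (0 : ℝ) ≤ N)]

theorem messages_rpow_mul_exp_le (hR : 0 ≤ R) {ρ : ℝ} (hρ : 0 ≤ ρ) (hρ1 : ρ ≤ 1) (a : ℝ) (N : ℕ) :
    (messages R N : ℝ) ^ ρ * Real.exp (-(N * a)) ≤
      (N + 2) * Real.exp (-(N * (a - ρ * R))) := by
  calc (messages R N : ℝ) ^ ρ * Real.exp (-(N * a))
      ≤ ((N + 2) * Real.exp (N * R)) ^ ρ * Real.exp (-(N * a)) := by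
        gcongr
        exact messages_le hR N
    _ = ((N : ℝ) + 2) ^ ρ * Real.exp (-(N * (a - ρ * R))) := by
        rw [Real.mul_rpow (by positivity) (Real.exp_pos _).le, ← Real.exp_mul, mul_assoc,
          ← Real.exp_add]
        ring_nf
    _ ≤ (N + 2) * Real.exp (-(N * (a - ρ * R))) := by
        gcongr
        exact Real.rpow_le_self_of_one_le (by linarith [N.cast_nonneg (α := ℝ)]) hρ1

theorem tendsto_add_two_mul_exp {κ : ℝ} (hκ : 0 < κ) :
    Tendsto (fun N : ℕ => ((N : ℝ) + 2) * Real.exp (-(N * κ))) atTop (𝓝 0) := by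
  have hpow (a : ℝ) := (tendsto_rpow_mul_exp_neg_mul_atTop_nhds_zero a κ hκ).comp
    (tendsto_natCast_atTop_atTop (R := ℝ))
  have hsum := (hpow 1).add ((hpow 0).const_mul 2)
  rw [mul_zero, add_zero] at hsum
  refine hsum.congr fun N => ?_
  simp only [Function.comp_apply, Real.rpow_one, Real.rpow_zero, neg_mul, mul_comm κ]
  ring

theorem tendsto_log_messages_div (hR : 0 ≤ R) :
    Tendsto (fun N : ℕ => Real.log (messages R N) / N) atTop (𝓝 R) := by
  have hupper : Tendsto (fun N : ℕ => R + (Real.log N / N + Real.log 3 / N)) atTop (𝓝 R) := by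
    have hlog := Real.isLittleO_log_id_atTop.tendsto_div_nhds_zero.comp
      (tendsto_natCast_atTop_atTop (R := ℝ))
    simpa using (hlog.add (tendsto_const_div_atTop_nhds_zero_nat (Real.log 3))).const_add R
  refine tendsto_of_tendsto_of_tendsto_of_le_of_le' tendsto_const_nhds hupper ?_ ?_
  · filter_upwards [eventually_ge_atTop 1] with N hN
    rw [le_div_iff₀ (Nat.cast_pos.2 hN), mul_comm,
      Real.le_log_iff_exp_le ((Real.exp_pos _).trans_le (exp_le_messages R N))]
    exact exp_le_messages R N
  · filter_upwards [eventually_ge_atTop 1] with N hN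
    have hN1 : (1 : ℝ) ≤ N := Nat.one_le_cast.2 hN
    have hN0 : (0 : ℝ) < N := by linarith
    rw [div_le_iff₀ hN0, Real.log_le_iff_le_exp ((Real.exp_pos _).trans_le (exp_le_messages R N))]
    calc (messages R N : ℝ) ≤ (N + 2) * Real.exp (N * R) := messages_le hR N
      _ ≤ N * 3 * Real.exp (N * R) := by gcongr; linarith
      _ = Real.exp ((R + (Real.log N / N + Real.log 3 / N)) * N) := by
        rw [← add_div, ← Real.log_mul hN0.ne' three_ne_zero, add_mul, div_mul_cancel₀ _ hN0.ne',
          Real.exp_add, Real.exp_log (by positivity)]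
        ring_nf

end Messages

section AchievedExponent

variable {X : Type u} {Y : Type v} [Fintype X] [Fintype Y] {W : X → Y → ℝ} {p : X → ℝ}
  {R : ℝ} {L : ℕ} {T : ℕ → ℝ}

theorem le_irExponent_of_eventually {M : ℕ → ℕ} {v : ℝ} (hT : ∀ k, 0 ≤ T k)
    (hM : Tendsto M atTop atTop)
    (hrate : Tendsto (fun N => Real.log (M N) / avgDelay W p L N (M N) T) atTop (𝓝 R))
    (h : ∀ᶠ N in atTop, 0 < avgDelay W p L N (M N) T ∧
      prError W p L N (M N) T ≤ Real.exp (-(v * avgDelay W p L N (M N) T))) :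
    (v : EReal) ≤ irExponent W p R L := by
  refine le_trans ?_ (le_sSup ⟨M, T, hT, hM, hrate, rfl⟩)
  refine le_limsup_of_frequently_le (Eventually.frequently ?_)
  filter_upwards [h] with N ⟨hpos, herr⟩
  rw [EReal.le_div_iff_mul_le (mod_cast hpos) (EReal.coe_ne_top _), ← EReal.coe_mul,
    EReal.le_neg, ← EReal.coe_neg, ← Real.log_exp (-(v * _)),
    ← ENNReal.log_ofReal_of_pos (Real.exp_pos _)]
  exact ENNReal.log_monotone (ENNReal.ofReal_le_ofReal herr)

theorem irExponent_nonneg {b : ℝ} (hW : ∀ x, W x ∈ stdSimplex ℝ Y) (hp : p ∈ stdSimplex ℝ X)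
    (hb : ∀ x x' y, W x y ≤ Real.exp b * W x' y) (hR : 0 ≤ R) (hL : 1 ≤ L) :
    0 ≤ irExponent W p R L := by
  have hL0 : (0 : ℝ) < L := Nat.cast_pos.2 hL
  have hdelay : ∀ᶠ N in atTop,
      avgDelay W p L N (messages (L * R) N) (fun _ => |b| + 1) = N * L := by
    filter_upwards [eventually_ge_atTop 2] with N hN
    exact avgDelay_eq_of_forall_lt hW hp hb (fun _ => (le_abs_self b).trans_lt (lt_add_one _))
      (hN.trans (le_messages _ N)) (one_le_two.trans hN)
  rw [← EReal.coe_zero]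
  refine le_irExponent_of_eventually (T := fun _ => |b| + 1) (fun _ => by positivity)
    (tendsto_messages (L * R)) ?_ ?_
  · have hrate := (tendsto_log_messages_div (R := L * R) (by positivity)).div_const (L : ℝ)
    rw [mul_div_cancel_left₀ _ hL0.ne'] at hrate
    refine hrate.congr' ?_
    filter_upwards [hdelay] with N hN
    rw [hN, div_div]
  · filter_upwards [hdelay, eventually_ge_atTop 1] with N hN hN1
    rw [hN, zero_mul, neg_zero, Real.exp_zero]
    exact ⟨mul_pos (Nat.cast_pos.2 hN1) hL0, prError_le_one hW hp (hN1.trans (le_messages _ N))⟩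

theorem tendsto_avgDelay_div (hW : ∀ x, W x ∈ stdSimplex ℝ Y) (hp : p ∈ stdSimplex ℝ X)
    (hR : 0 ≤ R) (hL : 1 ≤ L) {s ρ : ℝ} (hs : 0 < s) (hs1 : s < 1) (hsρ : s ≤ ρ) (hρ : ρ ≤ 1)
    (hEo : ρ * R + s * T 1 < Eo W s ρ p) :
    Tendsto (fun N : ℕ => avgDelay W p L N (messages R N) T / N) atTop (𝓝 1) := by
  have hκ : 0 < Eo W s ρ p - s * T 1 - ρ * R := by linarith
  have hupper := ((tendsto_add_two_mul_exp hκ).const_mul (L : ℝ)).const_add 1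
  rw [mul_zero, add_zero] at hupper
  refine tendsto_of_tendsto_of_tendsto_of_le_of_le' tendsto_const_nhds hupper ?_ ?_ <;>
    filter_upwards [eventually_ge_atTop 1] with N hN
  · rw [one_le_div (Nat.cast_pos.2 hN)]
    exact le_avgDelay hW hp (hN.trans (le_messages R N)) hL
  · rw [div_le_iff₀ (Nat.cast_pos.2 hN)]
    calc avgDelay W p L N (messages R N) T
        ≤ N + N * L * ((messages R N : ℝ) ^ ρ * Real.exp (-(N * (Eo W s ρ p - s * T 1)))) :=
          avgDelay_le hW hp (hN.trans (le_messages R N)) hL hs hs1 hsρ hρ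
      _ ≤ N + N * L * ((N + 2) * Real.exp (-(N * (Eo W s ρ p - s * T 1 - ρ * R)))) := by
          refine add_le_add_right (mul_le_mul_of_nonneg_left ?_ (by positivity)) _
          exact messages_rpow_mul_exp_le hR (hs.le.trans hsρ) hρ _ N
      _ = (1 + L * ((N + 2) * Real.exp (-(N * (Eo W s ρ p - s * T 1 - ρ * R))))) * N := by ring

theorem eventually_prError_le (hW : ∀ x, W x ∈ stdSimplex ℝ Y) (hp : p ∈ stdSimplex ℝ X)
    (hR : 0 ≤ R) {s ρ t w : ℝ} (hs : 0 < s) (hs1 : s < 1) (hsρ : s ≤ ρ) (hρ : ρ ≤ 1)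
    (ht : 0 ≤ t) (hwt : w < t) (hwL : w < L * Eo W s ρ p - ρ * R) :
    ∀ᶠ N : ℕ in atTop, prError W p L N (messages R N) (fun _ => t) ≤ Real.exp (-(N * w)) := by
  have hsmall := ((tendsto_add_two_mul_exp (sub_pos.2 hwt)).const_mul (L : ℝ)).add
    (tendsto_add_two_mul_exp (sub_pos.2 hwL))
  rw [mul_zero, add_zero] at hsmall
  filter_upwards [hsmall.eventually_lt_const one_pos, eventually_ge_atTop 1] with N hN hN1
  have hexp (a : ℝ) : Real.exp (-(N * a)) = Real.exp (-(N * w)) * Real.exp (-(N * (a - w))) := by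
    rw [← Real.exp_add]
    ring_nf
  have hfirst : ∀ k ∈ Finset.Ico 1 L, Real.exp (-(k * N * t)) ≤
      Real.exp (-(N * w)) * ((N + 2) * Real.exp (-(N * (t - w)))) := fun k hk => by
    have hk1 : (1 : ℝ) ≤ k := Nat.one_le_cast.2 (Finset.mem_Ico.1 hk).1
    calc Real.exp (-(k * N * t)) ≤ 1 * Real.exp (-(N * t)) := by
          rw [one_mul, mul_assoc]
          exact Real.exp_le_exp.2 (neg_le_neg (le_mul_of_one_le_left (by positivity) hk1))
      _ ≤ (N + 2) * Real.exp (-(N * t)) := by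
          gcongr
          linarith [N.cast_nonneg (α := ℝ)]
      _ = Real.exp (-(N * w)) * ((N + 2) * Real.exp (-(N * (t - w)))) := by
          rw [mul_left_comm, ← hexp]
  have hsum : ∑ k ∈ Finset.Ico 1 L, Real.exp (-(k * N * t)) ≤
      L * (Real.exp (-(N * w)) * ((N + 2) * Real.exp (-(N * (t - w))))) := by
    refine (Finset.sum_le_card_nsmul _ _ _ hfirst).trans ?_
    rw [nsmul_eq_mul, Nat.card_Ico]
    gcongr
    exact Nat.sub_le L 1
  have hlast := messages_rpow_mul_exp_le hR (hs.le.trans hsρ) hρ (L * Eo W s ρ p) N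
  calc prError W p L N (messages R N) (fun _ => t)
      ≤ _ := prError_le hW hp (hN1.trans (le_messages R N)) hs hs1 hsρ hρ
    _ ≤ L * (Real.exp (-(N * w)) * ((N + 2) * Real.exp (-(N * (t - w))))) +
          (N + 2) * Real.exp (-(N * (L * Eo W s ρ p - ρ * R))) := by
        refine add_le_add hsum ?_
        rwa [mul_left_comm, ← mul_assoc] at hlast
    _ = Real.exp (-(N * w)) * (L * ((N + 2) * Real.exp (-(N * (t - w)))) +
          (N + 2) * Real.exp (-(N * (L * Eo W s ρ p - ρ * R - w)))) := by
        rw [hexp (L * Eo W s ρ p - ρ * R)]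
        ring
    _ ≤ Real.exp (-(N * w)) := mul_le_of_le_one_right (Real.exp_pos _).le hN.le

theorem le_irExponent (hW : ∀ x, W x ∈ stdSimplex ℝ Y) (hp : p ∈ stdSimplex ℝ X) (hR : 0 ≤ R)
    (hL : 1 ≤ L) {s ρ s' ρ' t v : ℝ} (hs : 0 < s) (hs1 : s < 1) (hsρ : s ≤ ρ) (hρ : ρ ≤ 1)
    (hs' : 0 < s') (hs1' : s' < 1) (hsρ' : s' ≤ ρ') (hρ' : ρ' ≤ 1) (ht : 0 ≤ t)
    (hEo : ρ * R + s * t < Eo W s ρ p) (hvt : v < t) (hvL : v < L * Eo W s' ρ' p - ρ' * R) :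
    (v : EReal) ≤ irExponent W p R L := by
  obtain ⟨w, hvw, hw⟩ := exists_between (lt_min hvt hvL)
  have hratio := tendsto_avgDelay_div (T := fun _ => t) hW hp hR hL hs hs1 hsρ hρ hEo
  have herr := eventually_prError_le hW hp hR hs' hs1' hsρ' hρ' ht (lt_min_iff.1 hw).1
    (lt_min_iff.1 hw).2
  refine le_irExponent_of_eventually (fun _ => ht) (tendsto_messages R) ?_ ?_
  · have hrate := (tendsto_log_messages_div hR).div hratio one_ne_zero
    rw [div_one] at hrate
    refine hrate.congr' ?_
    filter_upwards [eventually_ge_atTop 1] with N hN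
    exact div_div_div_cancel_right₀ (Nat.cast_ne_zero.2 (Nat.one_le_iff_ne_zero.1 hN)) _ _
  · have hslow := (hratio.const_mul v).eventually_lt_const (u := w) (by rwa [mul_one])
    filter_upwards [hslow, herr, eventually_ge_atTop 1] with N hdelay herr hN
    have hN0 : (0 : ℝ) < N := Nat.cast_pos.2 hN
    refine ⟨hN0.trans_le (le_avgDelay hW hp (hN.trans (le_messages R N)) hL), herr.trans ?_⟩
    rw [mul_div_assoc', div_lt_iff₀ hN0, mul_comm w] at hdelay
    exact Real.exp_le_exp.2 (neg_le_neg hdelay.le)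

end AchievedExponent

section VeryNoisyIRARQ

variable {X : Type u} {Y : Type v} [Fintype X] [Fintype Y] {W : X → Y → ℝ} {p : X → ℝ}
  {δ R : ℝ} {L : ℕ}

theorem HasNoisyExponents.le_irExponent (h : HasNoisyExponents W p δ) (hδ : 0 < δ)
    (hδ1 : δ ≤ 1 / 8) (hW : ∀ x, W x ∈ stdSimplex ℝ Y) {b : ℝ}
    (hb : ∀ x x' y, W x y ≤ Real.exp b * W x' y) (hR : 0 ≤ R) (hRC : R ≤ capacity W)
    (hL : 4 ≤ L) :
    ((veryNoisyExponent (capacity W) R - 9 * δ * capacity W : ℝ) : EReal) ≤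
      irExponent W p R L := by
  have hL1 : 1 ≤ L := le_trans (by norm_num) hL
  set C := capacity W
  rcases le_or_gt (veryNoisyExponent C R - 9 * δ * C) 0 with hv | hv
  · exact le_trans (mod_cast hv) (irExponent_nonneg hW h.mem hb hR hL1)
  have hC : 0 < C := h.capacity_nonneg.lt_of_ne fun (hC : 0 = C) => by
    obtain rfl : R = 0 := le_antisymm (hC ▸ hRC) hR
    simp [← hC, veryNoisyExponent] at hv
  have hδC : 0 < δ * C := mul_pos hδ hC
  obtain ⟨s, ρ, hs, hs1, hsρ, hρ, hlt⟩ := exists_lt_mul_veryNoisyExponent hC hR hRC hδ hδ1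
  have hlast : veryNoisyExponent C R - 9 * δ * C < L * Eo W (1 / 2) 1 p - 1 * R := by
    have hRle : R ≤ √C * √R := (Real.mul_self_sqrt hR).symm.trans_le (by gcongr)
    have hEo : (1 - δ) * (1 / 2) * C ≤ Eo W (1 / 2) 1 p := by
      linarith [h.le_Eo (1 / 2) 1 (by norm_num) (by norm_num) le_rfl]
    calc veryNoisyExponent C R - 9 * δ * C < 4 * ((1 - δ) * (1 / 2) * C) - 1 * R := by
          rw [veryNoisyExponent_eq hC.le hR]
          linarith
      _ ≤ L * Eo W (1 / 2) 1 p - 1 * R := by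
          gcongr
          · exact mul_nonneg (by linarith) hC.le
          · exact_mod_cast hL
  exact ARQ.le_irExponent (t := veryNoisyExponent C R - 8 * δ * C) hW h.mem hR hL1 hs hs1 hsρ hρ
    (by norm_num) (by norm_num) (by norm_num) le_rfl (by linarith)
    (hlt.trans_le (h.le_Eo s ρ hs.le hsρ hρ)) (by linarith) hlast

end VeryNoisyIRARQ

end ARQ

end

theorem mainTheorem4_general (δ : ℝ) (hδ : 0 < δ) :
    ∃ η : ℝ, 0 < η ∧
      ∀ (X : Type u) (Y : Type v) [Fintype X] [Fintype Y] (W : X → Y → ℝ) (p : X → ℝ),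
        ARQ.IsVeryNoisy η W → ARQ.IsCapacityAchieving W p →
        ∀ R : ℝ, 0 ≤ R → R ≤ ARQ.capacity W →
          ((((ARQ.capacity W - R) + (√(ARQ.capacity W) - √R) ^ 2
              - δ * ARQ.capacity W : ℝ) : EReal) ≤ ARQ.feedbackExponent W R ∧
            ARQ.feedbackExponent W R ≤ (((ARQ.capacity W - R)
              + (√(ARQ.capacity W) - √R) ^ 2 + δ * ARQ.capacity W : ℝ) : EReal)) ∧
          ∀ L : ℕ, 4 ≤ L → ARQ.feedbackExponent W R ≤
            ARQ.irExponent W p R L + ((δ * ARQ.capacity W : ℝ) : EReal) := by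
  obtain ⟨d, hd, hd1, hdδ⟩ : ∃ d : ℝ, 0 < d ∧ d ≤ 1 / 8 ∧ 11 * d ≤ δ :=
    ⟨min (1 / 8) (δ / 11), lt_min (by norm_num) (by positivity), min_le_left _ _,
      by linarith [min_le_right (1 / 8) (δ / 11)]⟩
  refine ⟨d / 80, by positivity, fun X Y _ _ W p hW hp R hR hRC => ?_⟩
  have h := hW.hasNoisyExponents (by linarith) le_rfl hp
  obtain ⟨q, e, hc⟩ := hW.exists_isCentered (by linarith) hp.1
  have hdC := mul_nonneg hd.le h.capacity_nonneg
  have hδC := mul_le_mul_of_nonneg_right hdδ h.capacity_nonneg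
  have hupper := h.feedbackExponent_le hd.le hR hRC
  rw [← ARQ.veryNoisyExponent]
  refine ⟨⟨le_trans ?_ (h.le_feedbackExponent hd hd1 hR hRC), hupper.trans ?_⟩, fun L hL => ?_⟩
  · exact EReal.coe_le_coe_iff.2 (by linarith)
  · exact EReal.coe_le_coe_iff.2 (by linarith)
  · have hir := h.le_irExponent hd hd1 (hc.channel_mem (by linarith))
      (hc.channel_le_exp_mul (by linarith)) hR hRC hL
    refine (hupper.trans ?_).trans (add_le_add_left hir _)
    exact EReal.coe_le_coe_iff.2 (by linarith)

/-- Very noisy channels, deadline `L = 4`. The very noisy channel is the limit `η → 0` of channels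
`p(j|k) = ω_j (1 + ε_{jk})`, `|ε_{jk}| ≤ η`, in which exponents are compared to leading order, i.e.
up to an arbitrarily small fraction `δ` of the capacity. -/
theorem mainTheorem4 (δ : ℝ) (hδ : 0 < δ) :
    ∃ η : ℝ, 0 < η ∧
      ∀ (X : Type u) (Y : Type v) [Fintype X] [Fintype Y] (W : X → Y → ℝ) (p : X → ℝ),
        ARQ.IsVeryNoisy η W → ARQ.IsCapacityAchieving W p →
        ∀ R : ℝ, 0 ≤ R → R ≤ ARQ.capacity W →
          -- the feedback exponent of the very noisy channel
          ((((ARQ.capacity W - R) + (√(ARQ.capacity W) - √R) ^ 2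
              - δ * ARQ.capacity W : ℝ) : EReal) ≤ ARQ.feedbackExponent W R ∧
            ARQ.feedbackExponent W R ≤ (((ARQ.capacity W - R)
              + (√(ARQ.capacity W) - √R) ^ 2 + δ * ARQ.capacity W : ℝ) : EReal)) ∧
          -- incremental redundancy ARQ with deadline 4 achieves it
          ARQ.feedbackExponent W R ≤
            ARQ.irExponent W p R 4 + ((δ * ARQ.capacity W : ℝ) : EReal) := by
  obtain ⟨η, hη, h⟩ := mainTheorem4_general.{u, v} δ hδ
  exact ⟨η, hη, fun X Y _ _ W p hW hp R hR hRC =>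
    (h X Y W p hW hp R hR hRC).imp_right fun hL => hL 4 le_rfl⟩
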